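/- Let $\mathscr G$ be an ample groupoid, that is, a topological groupoid with source map $d$ and range map $r$ whose unit space $\mathscr G^{(0)}$ is locally compact Hausdorff with a basis of compact open sets and whose range map is a local homeomorphism ($\mathscr G$ itself need not be Hausdorff). Let $\mathcal O=(E,p,\alpha)$ be a $\mathscr G$-sheaf of unital rings: $p\colon E\to\mathscr G^{(0)}$ is a local homeomorphism, each stalk $\mathcal O_x=p^{-1}(x)$ is a unital ring, addition, multiplication and the unit section are continuous, and $\mathscr G$ acts continuously on $E$ by ring homomorphisms $\alpha_\gamma\colon\mathcal O_{d(\gamma)}\to\mathcal O_{r(\gamma)}$ with $\alpha_x=\mathrm{id}$ for units $x$ and $\alpha_\beta\alpha_\gamma=\alpha_{\beta\gamma}$ whenever $d(\beta)=r(\gamma)$. Let $\Gamma_c(\mathscr G,\mathcal O)$ be the additive group generated by all maps $f\colon\mathscr G\to E$ with $p\circ f=r$ for which there is a compact open set $U\subseteq\mathscr G$, on which $d$ and $r$ are injective, such that $f|_U$ is continuous and $f$ is zero outside $U$; it is a (not necessarily unital) ring under pointwise addition and the convolution $(f*g)(\gamma)=\sum_{\beta\rho=\gamma}f(\beta)\,\alpha_\beta(g(\rho))$.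 For $x\in\mathscr G^{(0)}$ let $\mathrm{Orb}(x)=r(d^{-1}(x))$, let $\mathscr G^x_x=\{\gamma\in\mathscr G: d(\gamma)=r(\gamma)=x\}$, and let $B_x=\mathcal O_x\rtimes\mathscr G^x_x$ be the skew group ring, with product $(a\delta)(b\varepsilon)=a\,\alpha_\delta(b)\,\delta\varepsilon$. A ring $R$ is left primitive if it has a faithful simple left module, where a left module $M$ is simple if $RM\neq 0$ and its only submodules are $0$ and $M$. 1. If $\Gamma_c(\mathscr G,\mathcal O)$ is left primitive, then there is $x\in\mathscr G^{(0)}$ such that every $f\in\Gamma_c(\mathscr G,\mathcal O)$ that vanishes on $d^{-1}(\mathrm{Orb}(x))$ is zero. 2. If there is $x\in\mathscr G^{(0)}$ such that $B_x$ is left primitive and every $f\in\Gamma_c(\mathscr G,\mathcal O)$ that vanishes on $d^{-1}(\mathrm{Orb}(x))$ is zero, then $\Gamma_c(\mathscr G,\mathcal O)$ is left primitive. -/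

import Mathlib

open CategoryTheory

universe u v w

namespace AmpleGroupoid

/-! ### Left primitive rings -/

/-- A (not necessarily unital) ring `R` is left primitive if it has a faithful simple left module.
A left module is an abelian group `M` with a ring homomorphism `ρ` from `R` to its additive
endomorphisms; it is faithful if `ρ` is injective, and simple if `R M ≠ 0` and the only
`R`-stable subgroups are `0` and `M`. (A simple module is cyclic, hence isomorphic to a quotient
of `R`, so nothing is lost by taking `M` in the universe of `R`; for a unital `R`, the condition
`R M ≠ 0` forces a simple module to be unital.) -/
def IsLeftPrimitive (R : Type u) [NonUnitalRing R] : Prop :=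
  ∃ (M : Type u) (_ : AddCommGroup M) (ρ : R →ₙ+* AddMonoid.End M),
    Function.Injective ρ ∧
    (∃ r m, ρ r m ≠ 0) ∧
    ∀ N : AddSubgroup M, (∀ r, ∀ n ∈ N, ρ r n ∈ N) → N = ⊥ ∨ N = ⊤

/-! ### Ample groupoids -/

/-- The arrow space of a groupoid with unit space `X`: an arrow has a source `d` and a
range `r`. -/
@[ext]
structure Arr (X : Type u) [Groupoid.{v} X] where
  {d : X}
  {r : X}
  hom : d ⟶ r

section Groupoids

variable (X : Type u) [Groupoid.{v} X]

/-- The pullback `{(β, γ) | d β = r γ}` of composable pairs of arrows. -/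
structure CompPair where
  {a : X}
  {b : X}
  {c : X}
  β : b ⟶ c
  γ : a ⟶ b

variable {X}

/-- The unit arrow at `x`. -/
def Arr.unit (x : X) : Arr X := ⟨𝟙 x⟩

/-- The inverse arrow. -/
def Arr.inv (γ : Arr X) : Arr X := ⟨Groupoid.inv γ.hom⟩

/-- The product `βγ` (first `γ`, then `β`) of a composable pair. -/
def CompPair.prod (q : CompPair X) : Arr X := ⟨q.γ ≫ q.β⟩

/-- A composable pair as a pair of arrows. -/
def CompPair.toPair (q : CompPair X) : Arr X × Arr X := (⟨q.β⟩, ⟨q.γ⟩)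

/-- The set of composable pairs has the subspace topology of the product. -/
instance [TopologicalSpace (Arr X)] : TopologicalSpace (CompPair X) :=
  TopologicalSpace.induced CompPair.toPair inferInstance

/-- The orbit `r(d⁻¹(x))` of a unit. -/
def Orb (x : X) : Set X := Arr.r '' {γ : Arr X | γ.d = x}

/-- A bisection: a set of arrows on which source and range are injective. -/
def IsBisection (U : Set (Arr X)) : Prop := Set.InjOn Arr.d U ∧ Set.InjOn Arr.r U

/-- A groupoid with a topology on its arrow space for which multiplication and inversion are
continuous; the unit space has the topology of the subspace of unit arrows. -/
class IsTopologicalGroupoid (X : Type u) [Groupoid.{v} X] [TopologicalSpace X]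
    [TopologicalSpace (Arr X)] : Prop where
  isEmbedding_unit : Topology.IsEmbedding (Arr.unit : X → Arr X)
  continuous_prod : Continuous (CompPair.prod : CompPair X → Arr X)
  continuous_inv : Continuous (Arr.inv : Arr X → Arr X)

/-- An étale groupoid: the unit space is locally compact and Hausdorff, and the range map is a
local homeomorphism. -/
class IsEtaleGroupoid (X : Type u) [Groupoid.{v} X] [TopologicalSpace X]
    [TopologicalSpace (Arr X)] : Prop extends IsTopologicalGroupoid X where
  t2 : T2Space X
  locallyCompact : LocallyCompactSpace X
  isLocalHomeomorph_r : IsLocalHomeomorph (Arr.r : Arr X → X)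

/-- An ample groupoid: an étale groupoid whose unit space has a basis of compact open sets. -/
class IsAmpleGroupoid (X : Type u) [Groupoid.{v} X] [TopologicalSpace X]
    [TopologicalSpace (Arr X)] : Prop extends IsEtaleGroupoid X where
  basis : TopologicalSpace.IsTopologicalBasis {U : Set X | IsCompact U ∧ IsOpen U}

end Groupoids

/-! ### Sheaves of rings -/

/-- The total space `E` of a family of stalks. -/
structure Total {X : Type u} (O : X → Type w) where
  {pt : X}
  val : O pt

/-- The pullback `{(e, e') | p e = p e'}` of the total space with itself. -/
structure TotalPair {X : Type u} (O : X → Type w) where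
  {pt : X}
  fst : O pt
  snd : O pt

/-- The pullback `{(γ, e) | d γ = p e}` of the arrow space and the total space. -/
structure ArrTotal (X : Type u) [Groupoid.{v} X] (O : X → Type w) where
  {a : X}
  {b : X}
  γ : a ⟶ b
  val : O a

section Pullbacks

variable {X : Type u} {O : X → Type w}

/-- An element of the pullback as a pair. -/
def TotalPair.toPair (q : TotalPair O) : Total O × Total O := (⟨q.fst⟩, ⟨q.snd⟩)

/-- The subspace topology of the product. -/
instance [TopologicalSpace (Total O)] : TopologicalSpace (TotalPair O) :=
  TopologicalSpace.induced TotalPair.toPair inferInstance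

variable [Groupoid.{v} X]

/-- An element of the pullback as a pair. -/
def ArrTotal.toPair (q : ArrTotal X O) : Arr X × Total O := (⟨q.γ⟩, ⟨q.val⟩)

/-- The subspace topology of the product. -/
instance [TopologicalSpace (Arr X)] [TopologicalSpace (Total O)] :
    TopologicalSpace (ArrTotal X O) :=
  TopologicalSpace.induced ArrTotal.toPair inferInstance

end Pullbacks

/-- A sheaf of unital rings over a topological groupoid with unit space `X`: a family of rings
(the stalks), a topology on their disjoint union `E` for which the projection `p : E → X` is a
local homeomorphism and the ring operations and the unit section are continuous, and a continuous
action of the groupoid by ring homomorphisms between stalks. -/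
structure RingSheaf (X : Type u) [Groupoid.{v} X] [TopologicalSpace X]
    [TopologicalSpace (Arr X)] where
  stalk : X → Type w
  [ring : ∀ x, Ring (stalk x)]
  [top : TopologicalSpace (Total stalk)]
  isLocalHomeomorph_pt : IsLocalHomeomorph (Total.pt : Total stalk → X)
  act : ∀ {x y : X}, (x ⟶ y) → stalk x →+* stalk y
  act_id : ∀ (x : X) (a : stalk x), act (𝟙 x) a = a
  act_comp : ∀ {x y z : X} (γ : x ⟶ y) (β : y ⟶ z) (a : stalk x),
    act (γ ≫ β) a = act β (act γ a)
  continuous_act :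
    Continuous (fun q : ArrTotal X stalk => (⟨act q.γ q.val⟩ : Total stalk))
  continuous_add :
    Continuous (fun q : TotalPair stalk => (⟨q.fst + q.snd⟩ : Total stalk))
  continuous_mul :
    Continuous (fun q : TotalPair stalk => (⟨q.fst * q.snd⟩ : Total stalk))
  continuous_one : Continuous (fun x : X => (⟨(1 : stalk x)⟩ : Total stalk))

namespace RingSheaf

variable {X : Type u} [Groupoid.{v} X] [TopologicalSpace X] [TopologicalSpace (Arr X)]

attribute [instance] RingSheaf.ring RingSheaf.top

variable (O : RingSheaf.{u, v, w} X)

/-! ### The isotropy skew group rings -/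

/-- The isotropy group at `x` acts on the stalk at `x` by ring automorphisms. -/
instance (x : X) : MulSemiringAction (End x) (O.stalk x) where
  smul δ a := O.act δ a
  one_smul a := O.act_id x a
  mul_smul δ ε a := O.act_comp ε δ a
  smul_zero δ := map_zero (O.act δ)
  smul_add δ a b := map_add (O.act δ) a b
  smul_one δ := map_one (O.act δ)
  smul_mul δ a b := map_mul (O.act δ) a b

/-- The isotropy skew group ring `B_x`, the skew group ring of the isotropy group at `x` over the
stalk at `x`, with product `(a δ) (b ε) = (a α_δ(b)) (δ ε)`. -/
abbrev isotropyRing (x : X) : Type (max v w) := SkewMonoidAlgebra (O.stalk x) (End x)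

/-! ### The convolution ring -/

/-- The maps `f` from the arrow space to `E` with `p ∘ f = r`. -/
abbrev Sec : Type (max u v w) := ∀ γ : Arr X, O.stalk γ.r

variable {O}

/-- `f` is supported on `U`: it is continuous on `U` and zero outside `U`. -/
def IsSupportedOn (f : O.Sec) (U : Set (Arr X)) : Prop :=
  ContinuousOn (fun γ => (⟨f γ⟩ : Total O.stalk)) U ∧ ∀ γ, γ ∉ U → f γ = 0

/-- The generators: sections supported on a compact open bisection. (Such a set is homeomorphic
to a subspace of the unit space, so it is automatically Hausdorff.) -/
def IsGenerator (f : O.Sec) : Prop :=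
  ∃ U : Set (Arr X), IsCompact U ∧ IsOpen U ∧ IsBisection U ∧ IsSupportedOn f U

variable (O) in
/-- `Γ_c(𝒢, 𝒪)` as an additive group. -/
def sections : AddSubgroup O.Sec := AddSubgroup.closure {f | IsGenerator f}

/-- The convolution `(f * g)(γ) = ∑ f(β) α_β(g(ρ))` over all factorizations `γ = βρ`,
which are indexed by the arrows `β` with `r(β) = r(γ)`, with `ρ = β⁻¹γ`. -/
noncomputable def conv (f g : O.Sec) : O.Sec := fun γ =>
  ∑ᶠ b : Σ y : X, (y ⟶ γ.r), f ⟨b.2⟩ * O.act b.2 (g ⟨γ.hom ≫ Groupoid.inv b.2⟩)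


section ConvolutionRing

/-! #### `Γ_c(𝒢, 𝒪)` is closed under convolution, which is bilinear and associative -/

theorem conv_of_mem {f : O.Sec} {U : Set (Arr X)} (hU : IsBisection U)
    (hf : ∀ γ, γ ∉ U → f γ = 0) (g : O.Sec) (γ : Arr X) {y : X} (β : y ⟶ γ.r)
    (hβ : (⟨β⟩ : Arr X) ∈ U) :
    conv f g γ = f ⟨β⟩ * O.act β (g ⟨γ.hom ≫ Groupoid.inv β⟩) := by
  unfold conv
  rw [finsum_eq_single _ (⟨y, β⟩ : Σ y : X, (y ⟶ γ.r))]
  rintro ⟨z, b⟩ hne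
  have hb : (⟨b⟩ : Arr X) ∉ U := by
    intro hb
    apply hne
    have h := hU.2 hb hβ rfl
    injection h with h1 _ h3
    subst h1
    rw [eq_of_heq h3]
  simp [hf _ hb]

theorem conv_of_not_mem {f : O.Sec} {U : Set (Arr X)}
    (hf : ∀ γ, γ ∉ U → f γ = 0) (g : O.Sec) (γ : Arr X)
    (h : ∀ (y : X) (β : y ⟶ γ.r), (⟨β⟩ : Arr X) ∉ U) : conv f g γ = 0 := by
  unfold conv
  rw [← finsum_zero (α := Σ y : X, (y ⟶ γ.r))]
  refine finsum_congr ?_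
  rintro ⟨y, b⟩
  simp [hf _ (h y b)]

theorem finite_fiber {f : O.Sec} (hf : f ∈ O.sections) (x : X) :
    {b : Σ y : X, (y ⟶ x) | f ⟨b.2⟩ ≠ 0}.Finite := by
  induction hf using AddSubgroup.closure_induction with
  | mem f hf =>
    obtain ⟨U, -, -, hU, hs⟩ := hf
    apply Set.Subsingleton.finite
    rintro ⟨y, b⟩ hb ⟨z, c⟩ hc
    have h1 : (⟨b⟩ : Arr X) ∈ U := by by_contra h; exact hb (hs.2 _ h)
    have h2 : (⟨c⟩ : Arr X) ∈ U := by by_contra h; exact hc (hs.2 _ h)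
    have h := hU.2 h1 h2 rfl
    injection h with h1 _ h3
    subst h1
    rw [eq_of_heq h3]
  | zero => simp
  | add f g _ _ hf hg =>
    refine (hf.union hg).subset ?_
    intro b hb
    by_contra h
    simp only [Set.mem_union, Set.mem_ofPred_eq, not_or, not_not] at h
    exact hb (by simp [h.1, h.2])
  | neg f _ hf => simpa using hf

theorem finite_conv_support {f : O.Sec} (hf : f ∈ O.sections) (g : O.Sec) (γ : Arr X) :
    (Function.support (M := O.stalk γ.r) fun b : Σ y : X, (y ⟶ γ.r) =>
      f ⟨b.2⟩ * O.act b.2 (g ⟨γ.hom ≫ Groupoid.inv b.2⟩)).Finite := by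
  refine (finite_fiber hf γ.r).subset ?_
  intro b hb h0
  exact hb (by simp [h0])

theorem zero_conv (g : O.Sec) : conv 0 g = 0 := by
  funext γ
  simp [conv]

theorem conv_zero (f : O.Sec) : conv f 0 = 0 := by
  funext γ
  simp [conv]

theorem add_conv {f f' : O.Sec} (hf : f ∈ O.sections) (hf' : f' ∈ O.sections) (g : O.Sec) :
    conv (f + f') g = conv f g + conv f' g := by
  funext γ
  simp only [conv, Pi.add_apply]
  rw [← finsum_add_distrib (finite_conv_support hf g γ) (finite_conv_support hf' g γ)]
  simp [add_mul]

theorem conv_add {f : O.Sec} (hf : f ∈ O.sections) (g g' : O.Sec) :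
    conv f (g + g') = conv f g + conv f g' := by
  funext γ
  simp only [conv, Pi.add_apply]
  rw [← finsum_add_distrib (finite_conv_support hf g γ) (finite_conv_support hf g' γ)]
  simp [mul_add]

theorem neg_conv (f g : O.Sec) : conv (-f) g = -conv f g := by
  funext γ
  simp only [conv, Pi.neg_apply]
  rw [← finsum_neg_distrib]
  simp

theorem conv_neg (f g : O.Sec) : conv f (-g) = -conv f g := by
  funext γ
  simp only [conv, Pi.neg_apply]
  rw [← finsum_neg_distrib]
  simp

theorem conv_assoc_of_generator {f : O.Sec} (hf : IsGenerator f) {g : O.Sec}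
    (hg : g ∈ O.sections) (h : O.Sec) : conv (conv f g) h = conv f (conv g h) := by
  obtain ⟨U, -, -, hU, hs⟩ := hf
  funext γ
  by_cases hγ : ∃ (y : X) (β : y ⟶ γ.r), (⟨β⟩ : Arr X) ∈ U
  · obtain ⟨y, β, hβ⟩ := hγ
    rw [conv_of_mem hU hs.2 _ γ β hβ]
    have h1 : ∀ b : Σ z : X, (z ⟶ γ.r), conv f g ⟨b.2⟩ =
        f ⟨β⟩ * O.act β (g ⟨b.2 ≫ Groupoid.inv β⟩) := fun b =>
      conv_of_mem hU hs.2 g ⟨b.2⟩ β hβ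
    have h2 : conv (conv f g) h γ = ∑ᶠ b : Σ z : X, (z ⟶ γ.r),
        (f ⟨β⟩ * O.act β (g ⟨b.2 ≫ Groupoid.inv β⟩)) *
          O.act b.2 (h ⟨γ.hom ≫ Groupoid.inv b.2⟩) :=
      finsum_congr fun b => by rw [h1]
    rw [h2]
    let e : (Σ z : X, (z ⟶ y)) ≃ (Σ z : X, (z ⟶ γ.r)) :=
      { toFun := fun c => ⟨c.1, c.2 ≫ β⟩
        invFun := fun b => ⟨b.1, b.2 ≫ Groupoid.inv β⟩
        left_inv := fun c => by simp
        right_inv := fun b => by simp }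
    rw [← finsum_comp_equiv e]
    let φ : O.stalk y →+ O.stalk γ.r :=
      (AddMonoidHom.mulLeft (f ⟨β⟩)).comp (O.act β).toAddMonoidHom
    have h3 := φ.map_finsum (finite_conv_support hg h ⟨γ.hom ≫ Groupoid.inv β⟩)
    refine Eq.trans ?_ h3.symm
    refine finsum_congr fun c => ?_
    change (f ⟨β⟩ * O.act β (g ⟨(c.2 ≫ β) ≫ Groupoid.inv β⟩)) *
        O.act (c.2 ≫ β) (h ⟨γ.hom ≫ Groupoid.inv (c.2 ≫ β)⟩) =
      f ⟨β⟩ * O.act β (g ⟨c.2⟩ *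
        O.act c.2 (h ⟨(γ.hom ≫ Groupoid.inv β) ≫ Groupoid.inv c.2⟩))
    have h4 : (c.2 ≫ β) ≫ Groupoid.inv β = c.2 := by simp
    have h5 : γ.hom ≫ Groupoid.inv (c.2 ≫ β) =
        (γ.hom ≫ Groupoid.inv β) ≫ Groupoid.inv c.2 := by
      simp [Groupoid.inv_eq_inv]
    rw [h4, h5, O.act_comp, map_mul, mul_assoc]
  · push Not at hγ
    rw [conv_of_not_mem hs.2 _ γ hγ]
    have h1 : ∀ b : Σ z : X, (z ⟶ γ.r), conv f g ⟨b.2⟩ = 0 := fun b =>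
      conv_of_not_mem hs.2 g ⟨b.2⟩ hγ
    unfold conv at h1 ⊢
    rw [← finsum_zero (α := Σ y : X, (y ⟶ γ.r))]
    exact finsum_congr fun b => by rw [h1, zero_mul]

section Closure

variable [IsAmpleGroupoid X]

theorem continuous_r : Continuous (Arr.r : Arr X → X) :=
  IsEtaleGroupoid.isLocalHomeomorph_r.continuous

theorem continuous_d : Continuous (Arr.d : Arr X → X) :=
  (continuous_r (X := X)).comp IsTopologicalGroupoid.continuous_inv

/-- The map `(β, γ) ↦ β⁻¹γ` on pairs of arrows with the same range. -/
def div (p : {p : Arr X × Arr X // p.1.r = p.2.r}) : Arr X :=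
  ⟨(p.1.2.hom ≫ eqToHom p.2.symm) ≫ Groupoid.inv p.1.1.hom⟩

theorem continuous_div : Continuous (div : {p : Arr X × Arr X // p.1.r = p.2.r} → Arr X) := by
  have h : Continuous (fun p : {p : Arr X × Arr X // p.1.r = p.2.r} =>
      (⟨Groupoid.inv p.1.1.hom, p.1.2.hom ≫ eqToHom p.2.symm⟩ : CompPair X)) := by
    refine continuous_induced_rng.2 ?_
    have h2 : (CompPair.toPair ∘ fun p : {p : Arr X × Arr X // p.1.r = p.2.r} =>
        (⟨Groupoid.inv p.1.1.hom, p.1.2.hom ≫ eqToHom p.2.symm⟩ : CompPair X)) =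
        fun p => (p.1.1.inv, p.1.2) := by
      funext ⟨⟨⟨α⟩, ⟨γ⟩⟩, hp⟩
      dsimp at hp
      subst hp
      simp [CompPair.toPair, Arr.inv]
    rw [h2]
    exact (IsTopologicalGroupoid.continuous_inv.comp
      (continuous_fst.comp continuous_subtype_val)).prodMk
        (continuous_snd.comp continuous_subtype_val)
  exact IsTopologicalGroupoid.continuous_prod.comp h

/-- The product `UV` of two sets of arrows. -/
def mulSet (U V : Set (Arr X)) : Set (Arr X) :=
  CompPair.prod '' (CompPair.toPair ⁻¹' (U ×ˢ V))

theorem isCompact_mulSet {U V : Set (Arr X)} (hU : IsCompact U) (hV : IsCompact V) :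
    IsCompact (mulSet U V) := by
  have : T2Space X := IsEtaleGroupoid.t2
  refine IsCompact.image ?_ IsTopologicalGroupoid.continuous_prod
  have hi : Topology.IsInducing (CompPair.toPair : CompPair X → _) := ⟨rfl⟩
  rw [hi.isCompact_iff]
  have h : CompPair.toPair '' (CompPair.toPair ⁻¹' (U ×ˢ V)) =
      (U ×ˢ V) ∩ {p : Arr X × Arr X | p.1.d = p.2.r} := by
    ext ⟨⟨β⟩, ⟨γ⟩⟩
    constructor
    · rintro ⟨q, hq, hq2⟩
      rw [← hq2]
      exact ⟨hq, rfl⟩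
    · rintro ⟨h1, h2⟩
      dsimp at h2
      subst h2
      exact ⟨⟨β, γ⟩, h1, rfl⟩
  rw [h]
  exact (hU.prod hV).inter_right
    (isClosed_eq (continuous_d.comp continuous_fst) (continuous_r.comp continuous_snd))

theorem isBisection_mulSet {U V : Set (Arr X)} (hU : IsBisection U) (hV : IsBisection V) :
    IsBisection (mulSet U V) := by
  constructor
  · rintro _ ⟨⟨β, γ⟩, ⟨h1, h2⟩, rfl⟩ _ ⟨⟨β', γ'⟩, ⟨h1', h2'⟩, rfl⟩ h
    have h3 := hV.1 h2 h2' h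
    injection h3 with a b c
    subst a b
    have h4 := hU.1 h1 h1' rfl
    injection h4 with a' b' c'
    subst b'
    obtain rfl := eq_of_heq c
    obtain rfl := eq_of_heq c'
    rfl
  · rintro _ ⟨⟨β, γ⟩, ⟨h1, h2⟩, rfl⟩ _ ⟨⟨β', γ'⟩, ⟨h1', h2'⟩, rfl⟩ h
    have h3 := hU.2 h1 h1' h
    injection h3 with a b c
    subst a b
    have h4 := hV.2 h2 h2' rfl
    injection h4 with a' b' c'
    subst a'
    obtain rfl := eq_of_heq c
    obtain rfl := eq_of_heq c'
    rfl

/-- On the arrows whose range is in `r(U)`, the arrow of `U` with the same range is a continuous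
function. -/
theorem exists_lift {U : Set (Arr X)} (hU : IsOpen U) (hb : IsBisection U) :
    ∃ σ : {γ : Arr X // γ.r ∈ Arr.r '' U} → {p : Arr X × Arr X // p.1.r = p.2.r},
      Continuous σ ∧ ∀ γ, (σ γ).1.2 = γ.1 ∧ (σ γ).1.1 ∈ U := by
  have hl : IsLocalHomeomorph (fun γ : U => γ.1.r) :=
    (IsEtaleGroupoid.isLocalHomeomorph_r (X := X)).comp
      hU.isOpenEmbedding_subtypeVal.isLocalHomeomorph
  have he := hl.isOpenEmbedding_of_injective
    (fun a b h => Subtype.ext (hb.2 a.2 b.2 h))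
  let e := he.toHomeomorph
  have hmem : ∀ γ : {γ : Arr X // γ.r ∈ Arr.r '' U},
      γ.1.r ∈ Set.range (fun γ : U => γ.1.r) := by
    rintro ⟨γ, β, hβ, h⟩
    exact ⟨⟨β, hβ⟩, h⟩
  have hr : ∀ γ : {γ : Arr X // γ.r ∈ Arr.r '' U},
      (e.symm ⟨γ.1.r, hmem γ⟩).1.r = γ.1.r := fun γ =>
    congrArg Subtype.val (e.apply_symm_apply ⟨γ.1.r, hmem γ⟩)
  refine ⟨fun γ => ⟨((e.symm ⟨γ.1.r, hmem γ⟩).1, γ.1), hr γ⟩, ?_, fun γ => ⟨rfl, ?_⟩⟩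
  · refine Continuous.subtype_mk (Continuous.prodMk ?_ continuous_subtype_val) _
    exact continuous_subtype_val.comp (e.symm.continuous.comp
      ((continuous_r.comp continuous_subtype_val).subtype_mk _))
  · exact (e.symm ⟨γ.1.r, hmem γ⟩).2

theorem mem_mulSet_iff {U V : Set (Arr X)} (hb : IsBisection U)
    (p : {p : Arr X × Arr X // p.1.r = p.2.r}) (hp : p.1.1 ∈ U) :
    p.1.2 ∈ mulSet U V ↔ div p ∈ V := by
  obtain ⟨⟨⟨α⟩, ⟨γ⟩⟩, h⟩ := p
  dsimp at h hp ⊢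
  subst h
  constructor
  · rintro ⟨⟨β, ρ⟩, ⟨h1, h2⟩, h3⟩
    injection h3 with a b c
    subst a b
    cases c
    have h4 := hb.2 h1 hp rfl
    injection h4 with a' b' c'
    subst a'
    cases c'
    simpa [div, CompPair.toPair] using h2
  · intro h
    refine ⟨⟨α, γ ≫ Groupoid.inv α⟩, ⟨hp, ?_⟩, ?_⟩
    · simpa [div, CompPair.toPair] using h
    · simp [CompPair.prod]

theorem isOpen_mulSet {U V : Set (Arr X)} (hU : IsOpen U) (hV : IsOpen V)
    (hb : IsBisection U) : IsOpen (mulSet U V) := by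
  obtain ⟨σ, hσ, hσ2⟩ := exists_lift hU hb
  have ho : IsOpen {γ : Arr X | γ.r ∈ Arr.r '' U} :=
    ((IsEtaleGroupoid.isLocalHomeomorph_r (X := X)).isOpenMap U hU).preimage continuous_r
  have h : mulSet U V = Subtype.val '' ((div ∘ σ) ⁻¹' V) := by
    ext γ
    constructor
    · intro hγ
      have hr : γ.r ∈ Arr.r '' U := by
        obtain ⟨⟨β, ρ⟩, ⟨h1, h2⟩, rfl⟩ := hγ
        exact ⟨⟨β⟩, h1, rfl⟩
      refine ⟨⟨γ, hr⟩, ?_, rfl⟩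
      refine (mem_mulSet_iff hb _ (hσ2 _).2).1 ?_
      rw [(hσ2 _).1]
      exact hγ
    · rintro ⟨γ, hγ, rfl⟩
      have := (mem_mulSet_iff hb (σ γ) (hσ2 _).2).2 hγ
      rwa [(hσ2 _).1] at this
  rw [h]
  exact ho.isOpenMap_subtype_val _ (hV.preimage (continuous_div.comp hσ))

theorem conv_generator {f g : O.Sec} (hf : IsGenerator f) (hg : IsGenerator g) :
    IsGenerator (conv f g) := by
  obtain ⟨U, hUc, hUo, hUb, hfc, hf0⟩ := hf
  obtain ⟨V, hVc, hVo, hVb, hgc, hg0⟩ := hg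
  refine ⟨mulSet U V, isCompact_mulSet hUc hVc, isOpen_mulSet hUo hVo hUb,
    isBisection_mulSet hUb hVb, ?_, ?_⟩
  · obtain ⟨σ, hσ, hσ2⟩ := exists_lift hUo hUb
    have hr : ∀ γ : mulSet U V, γ.1.r ∈ Arr.r '' U := by
      rintro ⟨_, ⟨β, ρ⟩, ⟨h1, h2⟩, rfl⟩
      exact ⟨⟨β⟩, h1, rfl⟩
    let τ : mulSet U V → {p : Arr X × Arr X // p.1.r = p.2.r} := fun γ => σ ⟨γ.1, hr γ⟩
    have hτ : Continuous τ := hσ.comp (continuous_subtype_val.subtype_mk _)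
    have hτ1 : ∀ γ, (τ γ).1.2 = γ.1 := fun γ => (hσ2 _).1
    have hτU : ∀ γ, (τ γ).1.1 ∈ U := fun γ => (hσ2 _).2
    have hτV : ∀ γ, div (τ γ) ∈ V := fun γ =>
      (mem_mulSet_iff hUb _ (hτU γ)).1 (by rw [hτ1]; exact γ.2)
    have hα : Continuous fun γ : mulSet U V => (τ γ).1.1 :=
      continuous_fst.comp (continuous_subtype_val.comp hτ)
    have c1 : Continuous fun γ : mulSet U V => (⟨f (τ γ).1.1⟩ : Total O.stalk) :=
      hfc.comp_continuous hα hτU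
    have c2 : Continuous fun γ : mulSet U V => (⟨g (div (τ γ))⟩ : Total O.stalk) :=
      hgc.comp_continuous (continuous_div.comp hτ) hτV
    have c3 : Continuous fun γ : mulSet U V =>
        (⟨(τ γ).1.1.hom, g (div (τ γ))⟩ : ArrTotal X O.stalk) :=
      continuous_induced_rng.2 (hα.prodMk c2)
    have c4 := O.continuous_act.comp c3
    have c5 : Continuous fun γ : mulSet U V =>
        (⟨f (τ γ).1.1, O.act (τ γ).1.1.hom (g (div (τ γ)))⟩ : TotalPair O.stalk) :=
      continuous_induced_rng.2 (c1.prodMk c4)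
    have c6 := O.continuous_mul.comp c5
    rw [continuousOn_iff_continuous_domRestrict]
    convert c6 using 1
    funext γ
    have key : ∀ p : {p : Arr X × Arr X // p.1.r = p.2.r}, p.1.1 ∈ U →
        (⟨conv f g p.1.2⟩ : Total O.stalk) =
          ⟨f p.1.1 * O.act p.1.1.hom (g (div p))⟩ := by
      rintro ⟨⟨⟨α⟩, ⟨γ⟩⟩, h⟩ hp
      dsimp at h hp
      subst h
      rw [conv_of_mem hUb hf0 g ⟨γ⟩ α hp]
      simp only [div, eqToHom_refl]
      rw [Category.comp_id]
    have := key (τ γ) (hτU γ)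
    rw [hτ1] at this
    exact this
  · intro γ hγ
    by_cases h : ∃ (y : X) (β : y ⟶ γ.r), (⟨β⟩ : Arr X) ∈ U
    · obtain ⟨y, β, hβ⟩ := h
      rw [conv_of_mem hUb hf0 g γ β hβ]
      have : (⟨γ.hom ≫ Groupoid.inv β⟩ : Arr X) ∉ V := by
        intro h
        exact hγ ⟨⟨β, γ.hom ≫ Groupoid.inv β⟩, ⟨hβ, h⟩, by simp [CompPair.prod]⟩
      rw [hg0 _ this, map_zero, mul_zero]
    · push Not at h
      exact conv_of_not_mem hf0 g γ h

theorem conv_mem {f g : O.Sec} (hf : f ∈ O.sections) (hg : g ∈ O.sections) :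
    conv f g ∈ O.sections := by
  have hf' := hf
  induction hf using AddSubgroup.closure_induction with
  | mem f hfg =>
    have hg' := hg
    induction hg using AddSubgroup.closure_induction with
    | mem g hgg => exact AddSubgroup.subset_closure (conv_generator hfg hgg)
    | zero => rw [conv_zero]; exact zero_mem _
    | add g g' h1 h2 ih1 ih2 => rw [conv_add hf']; exact add_mem (ih1 h1) (ih2 h2)
    | neg g h1 ih => rw [conv_neg]; exact neg_mem (ih h1)
  | zero => rw [zero_conv]; exact zero_mem _
  | add f f' h1 h2 ih1 ih2 => rw [add_conv h1 h2]; exact add_mem (ih1 h1) (ih2 h2)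
  | neg f h1 ih => rw [neg_conv]; exact neg_mem (ih h1)

theorem conv_assoc {f g : O.Sec} (hf : f ∈ O.sections) (hg : g ∈ O.sections) (h : O.Sec) :
    conv (conv f g) h = conv f (conv g h) := by
  induction hf using AddSubgroup.closure_induction with
  | mem f hf => exact conv_assoc_of_generator hf hg h
  | zero => simp only [zero_conv]
  | add f f' h1 h2 ih1 ih2 =>
    rw [add_conv h1 h2, add_conv (conv_mem h1 hg) (conv_mem h2 hg), add_conv h1 h2, ih1, ih2]
  | neg f h1 ih => simp only [neg_conv, ih]

end Closure

end ConvolutionRing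

variable (O) in
/-- The convolution ring `Γ_c(𝒢, 𝒪)`. -/
def Gamma : Type (max u v w) := O.sections

instance : CoeFun O.Gamma (fun _ => ∀ γ : Arr X, O.stalk γ.r) := ⟨fun f => f.1⟩

instance : AddCommGroup O.Gamma := inferInstanceAs (AddCommGroup O.sections)

/-- Addition is pointwise and multiplication is convolution. -/
noncomputable instance [IsAmpleGroupoid X] : NonUnitalRing O.Gamma :=
  { (inferInstance : AddCommGroup O.Gamma) with
    mul := fun f g => ⟨conv f.1 g.1, conv_mem f.2 g.2⟩
    left_distrib := fun f g h => Subtype.ext (conv_add f.2 g.1 h.1)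
    right_distrib := fun f g h => Subtype.ext (add_conv f.2 g.2 h.1)
    zero_mul := fun f => Subtype.ext (zero_conv f.1)
    mul_zero := fun f => Subtype.ext (conv_zero f.1)
    mul_assoc := fun f g h => Subtype.ext (conv_assoc f.2 g.2 h.1) }

end RingSheaf

end AmpleGroupoid

/-!
For the first part, regard a faithful simple `Γ_c(𝒢, 𝒪)`-module `M` as a sheaf of modules on the
unit space. As `M ≠ 0`, its stalk at some `x` is nonzero. The elements of `Γ_c(𝒢, 𝒪)` that vanish
on `d⁻¹(Orb(x))` form an ideal `I`. Each of them vanishes on all arrows with range near `x`, so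
`I M` lies in the kernel of the map from `M` to its stalk at `x`. Since this kernel is proper,
`I M = 0` by simplicity and `I = 0` by faithfulness.

For the second part, a faithful simple `B_x`-module induces an equivariant family of modules over
the orbit of `x`. Its finitely supported sections form a simple `Γ_c(𝒢, 𝒪)`-module, because compact
open bisections isolate the value of a section at a single point, and `f` acts by zero only if it
vanishes on `d⁻¹(Orb(x))`.
-/

universe t

namespace AmpleGroupoid

section Modules

variable {R : Type*} [NonUnitalRing R] {M : Type*} [AddCommGroup M]

/-- Simplicity of a left module over a not necessarily unital ring, given as in `IsLeftPrimitive`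
by the ring homomorphism `ρ` into the additive endomorphisms. -/
structure IsSimpleRep (ρ : R →ₙ+* AddMonoid.End M) : Prop where
  exists_ne_zero : ∃ r m, ρ r m ≠ 0
  eq_bot_or_eq_top : ∀ N : AddSubgroup M, (∀ r, ∀ n ∈ N, ρ r n ∈ N) → N = ⊥ ∨ N = ⊤

/-- The annihilator in `R` of an element of a left `R`-module. -/
def annihilator (ρ : R →ₙ+* AddMonoid.End M) (m : M) : AddSubgroup R :=
  ((AddMonoidHom.eval m).comp (ρ : R →+ AddMonoid.End M)).ker

theorem mem_annihilator {ρ : R →ₙ+* AddMonoid.End M} {m : M} {r : R} :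
    r ∈ annihilator ρ m ↔ ρ r m = 0 :=
  Iff.rfl

theorem map_mul_apply (ρ : R →ₙ+* AddMonoid.End M) (r s : R) (m : M) :
    ρ (r * s) m = ρ r (ρ s m) := by
  rw [map_mul]
  rfl

namespace IsSimpleRep

variable {ρ : R →ₙ+* AddMonoid.End M}

theorem eq_zero_of_forall_map_eq_zero (hρ : IsSimpleRep ρ) {m : M} (hm : ∀ r, ρ r m = 0) :
    m = 0 := by
  let N : AddSubgroup M := ⨅ r, (ρ r).ker
  have mem_N {n : M} : n ∈ N ↔ ∀ r, ρ r n = 0 := AddSubgroup.mem_iInf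
  rcases hρ.eq_bot_or_eq_top N fun r n hn ↦ by simp [mem_N.1 hn r] with hN | hN
  · rw [← AddSubgroup.mem_bot, ← hN]
    exact mem_N.2 hm
  · obtain ⟨r, n, hrn⟩ := hρ.exists_ne_zero
    exact absurd (mem_N.1 (hN ▸ AddSubgroup.mem_top n) r) hrn

theorem map_eq_zero_of_forall_mem (hρ : IsSimpleRep ρ) {I : Set R}
    (hI : ∀ r, ∀ s ∈ I, r * s ∈ I) {K : AddSubgroup M} (hK : K ≠ ⊤)
    (h : ∀ s ∈ I, ∀ m, ρ s m ∈ K) {s : R} (hs : s ∈ I) : ρ s = 0 := by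
  let N : AddSubgroup M := AddSubgroup.closure {n | ∃ s ∈ I, ∃ m, ρ s m = n}
  have hNK : N ≤ K := (AddSubgroup.closure_le K).2 <| by
    rintro _ ⟨s, hs, m, rfl⟩
    exact h s hs m
  have hN_stable (r : R) (n : M) (hn : n ∈ N) : ρ r n ∈ N := by
    suffices N ≤ N.comap (ρ r) from this hn
    refine (AddSubgroup.closure_le _).2 ?_
    rintro _ ⟨s, hs, m, rfl⟩
    exact AddSubgroup.subset_closure ⟨r * s, hI r s hs, m, map_mul_apply ρ r s m⟩
  have hN : N = ⊥ := (hρ.eq_bot_or_eq_top N hN_stable).resolve_right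
    fun hN ↦ hK (top_le_iff.1 (hN ▸ hNK))
  ext m
  exact AddSubgroup.mem_bot.1 (hN ▸ AddSubgroup.subset_closure ⟨s, hs, m, rfl⟩)

end IsSimpleRep

theorem IsSimpleRep.map_one {R : Type*} [Ring R] {ρ : R →ₙ+* AddMonoid.End M}
    (hρ : IsSimpleRep ρ) : ρ 1 = 1 := by
  ext m
  refine sub_eq_zero.1 (hρ.eq_zero_of_forall_map_eq_zero fun r ↦ ?_)
  have h : ρ r (ρ 1 m) = ρ r m := by
    rw [← map_mul_apply, mul_one]
  rw [map_sub, h, AddMonoid.End.one_apply, sub_self]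

theorem IsLeftPrimitive.exists_isSimpleModule {R : Type u} [Ring R] (h : IsLeftPrimitive R) :
    ∃ (V : Type u) (_ : AddCommGroup V) (_ : Module R V),
      IsSimpleModule R V ∧ FaithfulSMul R V := by
  obtain ⟨V, _, ρ, hinj, hne, hsimple⟩ := h
  have hρ : IsSimpleRep ρ := ⟨hne, hsimple⟩
  let ρ' : R →+* AddMonoid.End V := { ρ with map_one' := hρ.map_one }
  let _ : Module R V := Module.compHom V ρ'
  refine ⟨V, inferInstance, inferInstance, ?_, ⟨fun h ↦ hinj (AddMonoidHom.ext h)⟩⟩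
  obtain ⟨r, m, hrm⟩ := hne
  have : Nontrivial V := ⟨_, _, hrm⟩
  refine (isSimpleModule_iff R V).2 ⟨fun N ↦ ?_⟩
  refine (hsimple N.toAddSubgroup fun r n hn ↦ N.smul_mem r hn).imp ?_ ?_ <;>
    exact fun hN ↦ Submodule.toAddSubgroup_injective hN

end Modules

theorem finsum_sigma_eq_of_forall_ne {ι A : Type*} {κ : ι → Type*} [AddCommMonoid A]
    {F : (Σ i, κ i) → A} (i : ι) (h : ∀ j ≠ i, ∀ k, F ⟨j, k⟩ = 0) :
    ∑ᶠ p, F p = ∑ᶠ k, F ⟨i, k⟩ := by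
  rw [← finsum_mem_range (f := F) (sigma_mk_injective (i := i)), ← finsum_mem_univ]
  refine finsum_mem_inter_support_eq' _ _ _ fun ⟨j, k⟩ hjk ↦ iff_of_true trivial ?_
  obtain rfl : j = i := by_contra fun hji ↦ hjk (h j hji k)
  exact ⟨k, rfl⟩

namespace RingSheaf

open Filter Topology

variable {X : Type u} [Groupoid.{v} X] [TopologicalSpace X] [TopologicalSpace (Arr X)]
  {O : RingSheaf.{u, v, w} X}

/-! ### Continuous sections of the sheaf -/

section Stalks

theorem exists_continuousAt_section (x : X) (a : O.stalk x) :
    ∃ s : ∀ y, O.stalk y, s x = a ∧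
      ∀ᶠ y in 𝓝 x, ContinuousAt (fun y ↦ (⟨s y⟩ : Total O.stalk)) y := by
  obtain ⟨e, he, hpt⟩ := O.isLocalHomeomorph_pt ⟨a⟩
  have hx : x ∈ e.target := by simpa only [← hpt] using e.map_source he
  have hx_symm : e.symm x = ⟨a⟩ := by simpa only [← hpt] using e.left_inv he
  have exists_val (y : X) :
      ∃ b : O.stalk y, y ∈ e.target → (⟨b⟩ : Total O.stalk) = e.symm y := by
    by_cases hy : y ∈ e.target
    · obtain ⟨z, b, hb⟩ : ∃ (z : X) (b : O.stalk z), e.symm y = ⟨b⟩ := ⟨_, _, rfl⟩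
      obtain rfl : z = y := by simpa only [← hpt, hb] using e.right_inv hy
      exact ⟨b, fun _ ↦ hb.symm⟩
    · exact ⟨0, fun h ↦ absurd h hy⟩
  choose s hs using exists_val
  refine ⟨s, ?_, ?_⟩
  · injection (hs x hx).trans hx_symm
  · filter_upwards [e.open_target.mem_nhds hx] with y hy
    exact (e.continuousOn_symm.congr hs).continuousAt (e.open_target.mem_nhds hy)

variable {Y : Type*} [TopologicalSpace Y] {π : Y → X} {f g : ∀ y, O.stalk (π y)} {y : Y}

theorem eventually_eq_of_continuousAt
    (hf : ContinuousAt (fun y ↦ (⟨f y⟩ : Total O.stalk)) y)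
    (hg : ContinuousAt (fun y ↦ (⟨g y⟩ : Total O.stalk)) y) (h : f y = g y) :
    ∀ᶠ z in 𝓝 y, f z = g z := by
  obtain ⟨e, he, hpt⟩ := O.isLocalHomeomorph_pt ⟨f y⟩
  have he' : (⟨g y⟩ : Total O.stalk) ∈ e.source := h ▸ he
  filter_upwards [hf.eventually (e.open_source.mem_nhds he),
    hg.eventually (e.open_source.mem_nhds he')] with z hfz hgz
  injection e.injOn hfz hgz (by rw [← hpt])

theorem continuousAt_add
    (hf : ContinuousAt (fun y ↦ (⟨f y⟩ : Total O.stalk)) y)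
    (hg : ContinuousAt (fun y ↦ (⟨g y⟩ : Total O.stalk)) y) :
    ContinuousAt (fun y ↦ (⟨f y + g y⟩ : Total O.stalk)) y := by
  have h : ContinuousAt (fun y ↦ (⟨f y, g y⟩ : TotalPair O.stalk)) y := by
    have hind : IsInducing (TotalPair.toPair : TotalPair O.stalk → _) := ⟨rfl⟩
    exact hind.continuousAt_iff.2 (hf.prodMk hg)
  exact O.continuous_add.continuousAt.comp h

-- A local section `s` through `0` satisfies `s + s = s` at the base point, hence near it.
theorem continuous_zero : Continuous (fun x : X ↦ (⟨(0 : O.stalk x)⟩ : Total O.stalk)) := by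
  rw [continuous_iff_continuousAt]
  intro x
  obtain ⟨s, hsx, hs⟩ := exists_continuousAt_section x (0 : O.stalk x)
  have hs := hs.self_of_nhds
  have hadd : ∀ᶠ y in 𝓝 x, s y + s y = s y :=
    eventually_eq_of_continuousAt (π := id) (continuousAt_add (π := id) hs hs) hs (by simp [hsx])
  refine hs.congr ?_
  filter_upwards [hadd] with y hy
  rw [add_eq_left.1 hy]

theorem continuousAt_neg (hπ : ContinuousAt π y)
    (hf : ContinuousAt (fun y ↦ (⟨f y⟩ : Total O.stalk)) y) :
    ContinuousAt (fun y ↦ (⟨-f y⟩ : Total O.stalk)) y := by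
  obtain ⟨s, hsx, hs⟩ := exists_continuousAt_section (π y) (-f y)
  have hs : ContinuousAt (fun y ↦ (⟨s (π y)⟩ : Total O.stalk)) y :=
    ContinuousAt.comp (f := π) hs.self_of_nhds hπ
  have hadd : ∀ᶠ z in 𝓝 y, f z + s (π z) = 0 :=
    eventually_eq_of_continuousAt (continuousAt_add hf hs)
      (ContinuousAt.comp (f := π) continuous_zero.continuousAt hπ) (by simp [hsx])
  refine hs.congr ?_
  filter_upwards [hadd] with z hz
  rw [neg_eq_of_add_eq_zero_right hz]

end Stalks

/-! ### Bisections and generators -/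

section Bisections

theorem isLocalHomeomorph_inv [IsTopologicalGroupoid X] :
    IsLocalHomeomorph (Arr.inv : Arr X → Arr X) := by
  have involutive_inv : Function.Involutive (Arr.inv : Arr X → Arr X) := fun γ ↦ by simp [Arr.inv]
  exact Homeomorph.isLocalHomeomorph
    { involutive_inv.toPerm with
      continuous_toFun := IsTopologicalGroupoid.continuous_inv
      continuous_invFun := IsTopologicalGroupoid.continuous_inv }

theorem isLocalHomeomorph_d [IsEtaleGroupoid X] : IsLocalHomeomorph (Arr.d : Arr X → X) :=
  (IsEtaleGroupoid.isLocalHomeomorph_r (X := X)).comp isLocalHomeomorph_inv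

variable [IsAmpleGroupoid X]

theorem exists_isClopen_subset {x : X} {V : Set X} (hV : V ∈ 𝓝 x) :
    ∃ C ⊆ V, IsClopen C ∧ x ∈ C := by
  have : T2Space X := IsEtaleGroupoid.t2
  obtain ⟨K, ⟨hKc, hKo⟩, hx, hK⟩ := IsAmpleGroupoid.basis.mem_nhds_iff.1 hV
  exact ⟨K, hK, ⟨hKc.isClosed, hKo⟩, hx⟩

theorem exists_isBisection_subset (β : Arr X) {Ω : Set (Arr X)} (hΩ : Ω ∈ 𝓝 β) :
    ∃ W ⊆ Ω, IsCompact W ∧ IsOpen W ∧ IsBisection W ∧ β ∈ W := by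
  obtain ⟨e, he, hr⟩ := IsEtaleGroupoid.isLocalHomeomorph_r (X := X) β
  obtain ⟨e', he', hd⟩ := isLocalHomeomorph_d (X := X) β
  have hS : e.source ∩ (e'.source ∩ Ω) ∈ 𝓝 (e.symm (e β)) := by
    rw [e.left_inv he]
    exact inter_mem (e.open_source.mem_nhds he) (inter_mem (e'.open_source.mem_nhds he') hΩ)
  obtain ⟨K, ⟨hKc, hKo⟩, hβ, hK⟩ := IsAmpleGroupoid.basis.mem_nhds_iff.1 <|
    inter_mem (e.open_target.mem_nhds (e.map_source he))
      ((e.continuousAt_symm (e.map_source he)).preimage_mem_nhds hS)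
  have hKt : K ⊆ e.target := fun y hy ↦ (hK hy).1
  have hKS : e.symm '' K ⊆ e.source ∩ (e'.source ∩ Ω) :=
    Set.image_subset_iff.2 fun y hy ↦ (hK hy).2
  refine ⟨e.symm '' K, fun γ hγ ↦ (hKS hγ).2.2,
    hKc.image_of_continuousOn (e.continuousOn_symm.mono hKt),
    e.symm.isOpen_image_of_subset_source hKo hKt, ⟨?_, ?_⟩, e β, hβ, e.left_inv he⟩
  · exact hd ▸ e'.injOn.mono fun γ hγ ↦ (hKS hγ).2.1
  · exact hr ▸ e.injOn.mono fun γ hγ ↦ (hKS hγ).1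

theorem exists_generator (β : Arr X) (c : O.stalk β.r) {Ω : Set (Arr X)} (hΩ : Ω ∈ 𝓝 β) :
    ∃ f : O.Sec, IsGenerator f ∧ f β = c ∧
      ∃ W ⊆ Ω, IsBisection W ∧ β ∈ W ∧ ∀ γ, γ ∉ W → f γ = 0 := by
  classical
  obtain ⟨s, hsβ, hs⟩ := exists_continuousAt_section β.r c
  obtain ⟨W, hW, hWc, hWo, hWb, hβ⟩ := exists_isBisection_subset β
    (inter_mem hΩ (continuous_r.continuousAt.preimage_mem_nhds hs))
  let f : O.Sec := fun γ ↦ if γ ∈ W then s γ.r else 0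
  have f_of_mem {γ : Arr X} (hγ : γ ∈ W) : f γ = s γ.r := if_pos hγ
  have f_of_notMem (γ : Arr X) (hγ : γ ∉ W) : f γ = 0 := if_neg hγ
  refine ⟨f, ⟨W, hWc, hWo, hWb, fun γ hγ ↦ ?_, f_of_notMem⟩, (f_of_mem hβ).trans hsβ,
    W, fun γ hγ ↦ (hW hγ).1, hWb, hβ, f_of_notMem⟩
  have hsr : ContinuousAt (fun y ↦ (⟨s y⟩ : Total O.stalk)) γ.r := (hW hγ).2
  have hsγ : ContinuousAt (fun η : Arr X ↦ (⟨s η.r⟩ : Total O.stalk)) γ :=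
    ContinuousAt.comp (f := Arr.r) hsr continuous_r.continuousAt
  exact hsγ.continuousWithinAt.congr (fun η hη ↦ by rw [f_of_mem hη]) (by rw [f_of_mem hγ])

end Bisections

/-! ### Germs -/

section Germs

variable (O) in
/-- The maps that vanish on all arrows with range in some neighbourhood of `x`. -/
def vanishingNear (x : X) : AddSubgroup O.Sec where
  carrier := {f | ∀ᶠ γ in comap Arr.r (𝓝 x), f γ = 0}
  zero_mem' := Set.mem_ofPred.2 (Eventually.of_forall fun _ ↦ rfl)
  add_mem' {f g} hf hg := Set.mem_ofPred.2 <| by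
    filter_upwards [Set.mem_ofPred.1 hf, Set.mem_ofPred.1 hg] with γ hfγ hgγ
    rw [Pi.add_apply, hfγ, hgγ, add_zero]
  neg_mem' {f} hf := Set.mem_ofPred.2 <| by
    filter_upwards [Set.mem_ofPred.1 hf] with γ hfγ
    rw [Pi.neg_apply, hfγ, neg_zero]

theorem apply_eq_zero_of_mem_vanishingNear {γ : Arr X} {f : O.Sec}
    (hf : f ∈ O.vanishingNear γ.r) : f γ = 0 :=
  (eventually_comap.1 hf).self_of_nhds γ rfl

section Localized

variable [IsEtaleGroupoid X]

theorem continuous_zero_comp_r :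
    Continuous (fun γ : Arr X ↦ (⟨(0 : O.stalk γ.r)⟩ : Total O.stalk)) :=
  continuous_zero.comp IsEtaleGroupoid.isLocalHomeomorph_r.continuous

variable (O) in
/-- The maps that are continuous at `γ` and are carried near `γ`: an arrow `η` whose range is that
of an arrow `ω` close to `γ` contributes only if `η = ω`. -/
def localizedAt (γ : Arr X) : AddSubgroup O.Sec where
  carrier := {f | ContinuousAt (fun η ↦ (⟨f η⟩ : Total O.stalk)) γ ∧
    ∀ᶠ ω in 𝓝 γ, ∀ η : Arr X, η.r = ω.r → η ≠ ω → f η = 0}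
  zero_mem' := ⟨continuous_zero_comp_r.continuousAt, Eventually.of_forall fun _ _ _ _ ↦ rfl⟩
  add_mem' := by
    rintro f g ⟨hfc, hf⟩ ⟨hgc, hg⟩
    refine ⟨continuousAt_add hfc hgc, ?_⟩
    filter_upwards [hf, hg] with ω hfω hgω η hr hne
    rw [Pi.add_apply, hfω η hr hne, hgω η hr hne, add_zero]
  neg_mem' := by
    rintro f ⟨hfc, hf⟩
    refine ⟨continuousAt_neg IsEtaleGroupoid.isLocalHomeomorph_r.continuous.continuousAt hfc, ?_⟩
    filter_upwards [hf] with ω hfω η hr hne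
    rw [Pi.neg_apply, hfω η hr hne, neg_zero]

theorem apply_eq_zero_of_mem_localizedAt {γ η : Arr X} {f : O.Sec} (hf : f ∈ O.localizedAt γ)
    (hr : η.r = γ.r) (hne : η ≠ γ) : f η = 0 :=
  hf.2.self_of_nhds η hr hne

theorem mem_vanishingNear_of_mem_localizedAt {γ : Arr X} {f : O.Sec}
    (hf : f ∈ O.localizedAt γ) (h : f γ = 0) : f ∈ O.vanishingNear γ.r := by
  have hfγ : ∀ᶠ ω in 𝓝 γ, f ω = 0 :=
    eventually_eq_of_continuousAt hf.1 continuous_zero_comp_r.continuousAt h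
  have hfr : ∀ᶠ ω in 𝓝 γ, ∀ η : Arr X, η.r = ω.r → f η = 0 := by
    filter_upwards [hfγ, hf.2] with ω hω hη η hr
    by_cases hne : η = ω
    · rwa [hne]
    · exact hη η hr hne
  refine eventually_comap.2 ?_
  rwa [← IsEtaleGroupoid.isLocalHomeomorph_r.map_nhds_eq, eventually_map]

theorem sections_le_vanishingNear_sup_iSup_localizedAt (x : X) :
    O.sections ≤ O.vanishingNear x ⊔ ⨆ γ : {γ : Arr X // γ.r = x}, O.localizedAt γ.1 := by
  have : T2Space X := IsEtaleGroupoid.t2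
  refine (AddSubgroup.closure_le _).2 ?_
  rintro f ⟨W, hWc, hWo, hWb, hfc, hf⟩
  by_cases hx : x ∈ Arr.r '' W
  · obtain ⟨γ, hγ, rfl⟩ := hx
    refine AddSubgroup.mem_sup_right <| AddSubgroup.mem_iSup_of_mem
      (⟨γ, rfl⟩ : {η : Arr X // η.r = γ.r}) ⟨hfc.continuousAt (hWo.mem_nhds hγ), ?_⟩
    filter_upwards [hWo.mem_nhds hγ] with ω hω η hr hne
    exact hf η fun hη ↦ hne (hWb.2 hη hω hr)
  · refine AddSubgroup.mem_sup_left (eventually_comap.2 ?_)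
    have hW : IsClosed (Arr.r '' W) :=
      (hWc.image IsEtaleGroupoid.isLocalHomeomorph_r.continuous).isClosed
    filter_upwards [hW.isOpen_compl.mem_nhds hx] with y hy γ hγ
    exact hf γ fun hγW ↦ hy ⟨γ, hγW, hγ⟩

-- `𝒢` need not be Hausdorff, so a zero of `f` at one arrow need not spread to a neighbourhood:
-- the germ vanishes only because `f` vanishes on the whole fibre of `r` over `x`.
theorem mem_vanishingNear_of_forall_eq_zero {f : O.Sec} (hf : f ∈ O.sections) {x : X}
    (h : ∀ γ : Arr X, γ.r = x → f γ = 0) : f ∈ O.vanishingNear x := by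
  obtain ⟨g, hg, k, hk, rfl⟩ :=
    AddSubgroup.mem_sup.1 (sections_le_vanishingNear_sup_iSup_localizedAt x hf)
  refine add_mem hg ?_
  have hk_zero (γ : Arr X) (hγ : γ.r = x) : k γ = 0 := by
    have hgγ : g γ = 0 := apply_eq_zero_of_mem_vanishingNear (hγ ▸ hg)
    simpa only [Pi.add_apply, hgγ, zero_add] using h γ hγ
  have hk' : k ∈ ⨆ γ : {γ : Arr X // γ.r = x}, (O.localizedAt γ.1).toIntSubmodule := by
    rwa [← AddSubgroup.toIntSubmodule.map_iSup]
  obtain ⟨c, hc, rfl⟩ := (Submodule.mem_iSup_iff_exists_finsupp _ _).1 hk'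
  refine sum_mem fun γ _ ↦ ?_
  suffices hcγ : c γ γ.1 = 0 by
    simpa only [γ.2] using mem_vanishingNear_of_mem_localizedAt (hc γ) hcγ
  have hsum := hk_zero γ.1 γ.2
  rw [Finsupp.sum, Finset.sum_apply, Finset.sum_eq_single γ] at hsum
  · exact hsum
  · intro η _ hne
    exact apply_eq_zero_of_mem_localizedAt (hc η) (γ.2.trans η.2.symm)
      fun h ↦ hne (Subtype.ext h.symm)
  · intro hγ
    rw [Finsupp.notMem_support_iff.1 hγ]
    rfl

end Localized

end Germs

/-! ### Supports in the unit space -/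

section Support

namespace Gamma

theorem ext {f g : O.Gamma} (h : ∀ γ, f γ = g γ) : f = g :=
  Subtype.ext (funext h)

theorem add_apply (f g : O.Gamma) (γ : Arr X) : (f + g) γ = f γ + g γ :=
  rfl

end Gamma

theorem conv_apply_eq_zero {f g : O.Sec} {γ : Arr X}
    (h : ∀ (y : X) (β : y ⟶ γ.r), f ⟨β⟩ = 0 ∨ g ⟨γ.hom ≫ Groupoid.inv β⟩ = 0) :
    conv f g γ = 0 := by
  refine finsum_eq_zero_of_forall_eq_zero fun ⟨y, β⟩ ↦ ?_
  rcases h y β with hf | hg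
  · rw [hf, zero_mul]
  · rw [hg, map_zero, mul_zero]

open Classical in
/-- Restriction to the arrows with source in `C`, extended by zero. -/
noncomputable def restrict (C : Set X) : O.Sec →+ O.Sec where
  toFun f γ := if γ.d ∈ C then f γ else 0
  map_zero' := by
    funext γ
    simp
  map_add' f g := by
    funext γ
    by_cases hγ : γ.d ∈ C <;> simp [hγ]

theorem restrict_of_mem {C : Set X} (f : O.Sec) {γ : Arr X} (hγ : γ.d ∈ C) :
    restrict C f γ = f γ :=
  if_pos hγ

theorem restrict_of_notMem {C : Set X} (f : O.Sec) {γ : Arr X} (hγ : γ.d ∉ C) :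
    restrict C f γ = 0 :=
  if_neg hγ

variable (O) in
/-- The elements of `Γ_c(𝒢, 𝒪)` that vanish on the arrows with source outside `V`. -/
def sourceSupported (V : Set X) : AddSubgroup O.Gamma where
  carrier := {f | ∀ γ : Arr X, γ.d ∉ V → f γ = 0}
  zero_mem' _ _ := rfl
  add_mem' {f g} hf hg γ hγ := by rw [Gamma.add_apply, hf γ hγ, hg γ hγ, add_zero]
  neg_mem' {f} hf γ hγ := neg_eq_zero.2 (hf γ hγ)

theorem sourceSupported_mono {V W : Set X} (h : V ⊆ W) :
    O.sourceSupported V ≤ O.sourceSupported W :=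
  fun _ hf γ hγ ↦ hf γ fun hγV ↦ hγ (h hγV)

theorem sourceSupported_empty : O.sourceSupported (∅ : Set X) = ⊥ :=
  (AddSubgroup.eq_bot_iff_forall _).2 fun _ hf ↦ Gamma.ext fun γ ↦ hf γ (Set.notMem_empty _)

variable [IsAmpleGroupoid X]

theorem restrict_mem_sections {C : Set X} (hC : IsClopen C) {f : O.Sec} (hf : f ∈ O.sections) :
    restrict C f ∈ O.sections := by
  suffices O.sections ≤ O.sections.comap (restrict C) from this hf
  refine (AddSubgroup.closure_le _).2 ?_
  rintro f ⟨W, hWc, hWo, hWb, hfc, hf⟩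
  refine AddSubgroup.subset_closure ⟨W ∩ Arr.d ⁻¹' C,
    hWc.inter_right (hC.1.preimage continuous_d), hWo.inter (hC.2.preimage continuous_d),
    ⟨hWb.1.mono Set.inter_subset_left, hWb.2.mono Set.inter_subset_left⟩, ?_, fun γ hγ ↦ ?_⟩
  · refine (hfc.mono Set.inter_subset_left).congr fun γ hγ ↦ ?_
    rw [restrict_of_mem (C := C) f hγ.2]
  · by_cases hγC : γ.d ∈ C
    · rw [restrict_of_mem f hγC, hf γ fun hγW ↦ hγ ⟨hγW, hγC⟩]
    · exact restrict_of_notMem f hγC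

theorem sourceSupported_union_le {C : Set X} (hC : IsClopen C) (D : Set X) :
    O.sourceSupported (C ∪ D) ≤ O.sourceSupported C ⊔ O.sourceSupported D := by
  intro f hf
  let g : O.Gamma := ⟨restrict C f.1, restrict_mem_sections hC f.2⟩
  let k : O.Gamma := ⟨restrict Cᶜ f.1, restrict_mem_sections hC.compl f.2⟩
  have hgk : g + k = f := Gamma.ext fun γ ↦ by
    rw [Gamma.add_apply]
    by_cases hγ : γ.d ∈ C
    · simp only [g, k, restrict_of_mem f.1 hγ, restrict_of_notMem f.1 (Set.notMem_compl_iff.2 hγ),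
        add_zero]
    · simp only [g, k, restrict_of_notMem f.1 hγ, restrict_of_mem f.1 (Set.mem_compl hγ), zero_add]
  rw [← hgk]
  refine AddSubgroup.add_mem_sup (fun γ hγ ↦ restrict_of_notMem f.1 hγ) fun γ hγ ↦ ?_
  by_cases hγC : γ.d ∈ C
  · exact restrict_of_notMem f.1 (Set.notMem_compl_iff.2 hγC)
  · exact (restrict_of_mem f.1 hγC).trans (hf γ fun h ↦ h.elim hγC hγ)

theorem exists_isCompact_mem_sourceSupported (f : O.Gamma) :
    ∃ K, IsCompact K ∧ f ∈ O.sourceSupported K := by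
  obtain ⟨f, hf⟩ := f
  induction hf using AddSubgroup.closure_induction with
  | mem f hf =>
    obtain ⟨W, hWc, -, -, -, hf⟩ := hf
    exact ⟨Arr.d '' W, hWc.image continuous_d, fun γ hγ ↦ hf γ fun hγW ↦ hγ ⟨γ, hγW, rfl⟩⟩
  | zero => exact ⟨∅, isCompact_empty, zero_mem _⟩
  | add f g _ _ hf hg =>
    obtain ⟨K, hK, hf⟩ := hf
    obtain ⟨L, hL, hg⟩ := hg
    exact ⟨K ∪ L, hK.union hL, add_mem (sourceSupported_mono Set.subset_union_left hf)
      (sourceSupported_mono Set.subset_union_right hg)⟩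
  | neg f _ hf =>
    obtain ⟨K, hK, hf⟩ := hf
    exact ⟨K, hK, neg_mem hf⟩

theorem eq_top_of_forall_exists_sourceSupported_le {A : AddSubgroup O.Gamma}
    (hA : ∀ x, ∃ V ∈ 𝓝 x, O.sourceSupported V ≤ A) : A = ⊤ := by
  refine (AddSubgroup.eq_top_iff' A).2 fun f ↦ ?_
  obtain ⟨K, hK, hf⟩ := exists_isCompact_mem_sourceSupported f
  obtain ⟨C, -, hKC, hCA⟩ : ∃ C, IsClopen C ∧ K ⊆ C ∧ O.sourceSupported C ≤ A := by
    refine hK.induction_on ⟨∅, isClopen_empty, subset_rfl, sourceSupported_empty.trans_le bot_le⟩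
      (fun S T hST ⟨C, hC, hTC, hCA⟩ ↦ ⟨C, hC, hST.trans hTC, hCA⟩) ?_ fun x _ ↦ ?_
    · rintro S T ⟨C, hC, hSC, hCA⟩ ⟨D, hD, hTD, hDA⟩
      exact ⟨C ∪ D, hC.union hD, Set.union_subset_union hSC hTD,
        (sourceSupported_union_le hC D).trans (sup_le hCA hDA)⟩
    · obtain ⟨V, hV, hVA⟩ := hA x
      obtain ⟨C, hCV, hC, hx⟩ := exists_isClopen_subset hV
      exact ⟨C, mem_nhdsWithin_of_mem_nhds (hC.2.mem_nhds hx), C, hC, subset_rfl,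
        (sourceSupported_mono hCV).trans hVA⟩
  exact hCA (sourceSupported_mono hKC hf)

end Support

/-! ### The stalks of a module -/

section ModuleStalks

variable [IsAmpleGroupoid X]

theorem mul_eq_zero_of_mem_sourceSupported {f g : O.Gamma} {V : Set X}
    (hf : f ∈ O.sourceSupported V) (hg : ∀ γ : Arr X, γ.r ∈ V → g γ = 0) : f * g = 0 :=
  Gamma.ext fun γ ↦ conv_apply_eq_zero fun y β ↦
    (em (y ∈ V)).symm.imp (hf ⟨β⟩) (hg ⟨γ.hom ≫ Groupoid.inv β⟩)

variable {M : Type*} [AddCommGroup M]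

/-- A `Γ_c(𝒢, 𝒪)`-module `M` corresponds to a sheaf of modules on the unit space; this is the
kernel of the map from `M` to its stalk at `x`. -/
def stalkKernel (ρ : O.Gamma →ₙ+* AddMonoid.End M) (x : X) : AddSubgroup M where
  carrier := {m | ∃ V ∈ 𝓝 x, O.sourceSupported V ≤ annihilator ρ m}
  zero_mem' := ⟨Set.univ, univ_mem, fun f _ ↦ map_zero (ρ f)⟩
  add_mem' := by
    rintro m n ⟨V, hV, hm⟩ ⟨W, hW, hn⟩
    refine ⟨V ∩ W, inter_mem hV hW, fun f hf ↦ ?_⟩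
    rw [mem_annihilator, map_add, mem_annihilator.1 (hm (sourceSupported_mono (by simp) hf)),
      mem_annihilator.1 (hn (sourceSupported_mono (by simp) hf)), add_zero]
  neg_mem' := by
    rintro m ⟨V, hV, hm⟩
    refine ⟨V, hV, fun f hf ↦ ?_⟩
    rw [mem_annihilator, map_neg, mem_annihilator.1 (hm hf), neg_zero]

theorem exists_notMem_stalkKernel {ρ : O.Gamma →ₙ+* AddMonoid.End M} {f : O.Gamma} {m : M}
    (hfm : ρ f m ≠ 0) : ∃ x, m ∉ stalkKernel ρ x := by
  by_contra! hm
  have htop : annihilator ρ m = ⊤ := eq_top_of_forall_exists_sourceSupported_le hm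
  exact hfm (mem_annihilator.1 (htop ▸ AddSubgroup.mem_top f))

theorem map_mem_stalkKernel (ρ : O.Gamma →ₙ+* AddMonoid.End M) {f : O.Gamma} {x : X}
    (hf : ∀ γ : Arr X, γ.r = x → f γ = 0) (m : M) : ρ f m ∈ stalkKernel ρ x := by
  have hfx : ∀ᶠ y in 𝓝 x, ∀ γ : Arr X, γ.r = y → f γ = 0 :=
    eventually_comap.1 (mem_vanishingNear_of_forall_eq_zero f.2 hf)
  refine ⟨_, hfx, fun g hg ↦ ?_⟩
  have hgf : g * f = 0 := mul_eq_zero_of_mem_sourceSupported hg fun γ hγ ↦ hγ γ rfl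
  rw [mem_annihilator, ← map_mul_apply, hgf, map_zero]
  rfl

theorem exists_orbit_of_isLeftPrimitive (h : IsLeftPrimitive O.Gamma) :
    ∃ x : X, ∀ f : O.Gamma, (∀ γ : Arr X, γ.d ∈ Orb x → f γ = 0) → f = 0 := by
  obtain ⟨M, _, ρ, hinj, ⟨r, m, hrm⟩, hsimple⟩ := h
  obtain ⟨x, hx⟩ := exists_notMem_stalkKernel hrm
  let I : Set O.Gamma := {f | ∀ γ : Arr X, γ.d ∈ Orb x → f γ = 0}
  have I_mul_mem (g f : O.Gamma) (hf : f ∈ I) : g * f ∈ I :=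
    fun γ hγ ↦ conv_apply_eq_zero fun _ _ ↦ Or.inr (hf _ hγ)
  have map_mem (f : O.Gamma) (hf : f ∈ I) (m : M) : ρ f m ∈ stalkKernel ρ x := by
    refine map_mem_stalkKernel ρ (fun γ hγ ↦ hf γ ?_) m
    exact ⟨γ.inv, hγ, rfl⟩
  have stalkKernel_ne_top : stalkKernel ρ x ≠ ⊤ := fun h ↦ hx (h ▸ AddSubgroup.mem_top m)
  refine ⟨x, fun f hf ↦ hinj ?_⟩
  rw [map_zero]
  exact IsSimpleRep.map_eq_zero_of_forall_mem ⟨⟨r, m, hrm⟩, hsimple⟩ I_mul_mem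
    stalkKernel_ne_top map_mem hf

end ModuleStalks

/-! ### Equivariant modules -/

theorem Gamma.addHom_ext {A : Type*} [AddCommGroup A] {φ ψ : O.Gamma →+ A}
    (h : ∀ f : O.Gamma, IsGenerator f.1 → φ f = ψ f) : φ = ψ :=
  AddMonoidHom.eq_of_eqOn_dense (AddSubgroup.closure_closure_coe_preimage) h

theorem finite_source_fiber {f : O.Sec} (hf : f ∈ O.sections) (y : X) :
    {β : Σ z : X, (y ⟶ z) | f ⟨β.2⟩ ≠ 0}.Finite := by
  induction hf using AddSubgroup.closure_induction with
  | mem f hf =>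
    obtain ⟨W, -, -, hWb, hf⟩ := hf
    refine Set.Subsingleton.finite fun ⟨z, β⟩ hβ ⟨z', β'⟩ hβ' ↦ ?_
    have h : (⟨β⟩ : Arr X) = ⟨β'⟩ :=
      hWb.1 (not_imp_comm.1 (hf.2 ⟨β⟩) hβ) (not_imp_comm.1 (hf.2 ⟨β'⟩) hβ') rfl
    cases h
    rfl
  | zero => simp
  | add f g _ _ hf hg =>
    refine (hf.union hg).subset fun β hβ ↦ or_iff_not_imp_left.2 fun hfβ hgβ ↦ hβ ?_
    rw [Pi.add_apply, not_not.1 hfβ, hgβ, add_zero]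
  | neg f _ hf => simpa using hf

theorem conv_comp_of_mem {f g : O.Sec} {W : Set (Arr X)} (hW : Set.InjOn Arr.d W)
    (hg : ∀ γ, γ ∉ W → g γ = 0) {x y z : X} {ρ : x ⟶ y} (hρ : (⟨ρ⟩ : Arr X) ∈ W) (β : y ⟶ z) :
    conv f g ⟨ρ ≫ β⟩ = f ⟨β⟩ * O.act β (g ⟨ρ⟩) := by
  unfold conv
  rw [finsum_eq_single _ (⟨y, β⟩ : Σ y : X, (y ⟶ z))]
  · have h : (ρ ≫ β) ≫ Groupoid.inv β = ρ := by
      rw [Category.assoc, Groupoid.comp_inv, Category.comp_id]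
    rw [h]
  · rintro ⟨y', β'⟩ hne
    have hnot : (⟨(ρ ≫ β) ≫ Groupoid.inv β'⟩ : Arr X) ∉ W := by
      intro hmem
      have h := hW hmem hρ rfl
      injection h with _ hy hρ'
      subst hy
      rw [Groupoid.inv_eq_inv, heq_iff_eq, IsIso.comp_inv_eq, cancel_epi] at hρ'
      exact hne (hρ' ▸ rfl)
    rw [hg _ hnot, map_zero, mul_zero]

variable (O) in
/-- An equivariant family of left modules over the stalks. No topology on the union of the fibres is
needed, since only sections with finite support are considered. -/
structure EquivariantModule where
  fiber : X → Type t
  [addCommGroup : ∀ y, AddCommGroup (fiber y)]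
  [module : ∀ y, Module (O.stalk y) (fiber y)]
  map : ∀ {y z : X} (β : y ⟶ z), fiber y →ₛₗ[O.act β] fiber z
  map_id : ∀ (y : X) (m : fiber y), map (𝟙 y) m = m
  map_comp : ∀ {x y z : X} (ρ : x ⟶ y) (β : y ⟶ z) (m : fiber x),
    map (ρ ≫ β) m = map β (map ρ m)

namespace EquivariantModule

attribute [instance] EquivariantModule.addCommGroup EquivariantModule.module

open DirectSum

variable (M : EquivariantModule.{u, v, w, t} O)

/-- Irreducibility: some fibre is nonzero and every nonzero element of a fibre generates the
whole family. -/
structure IsIrreducible : Prop where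
  exists_nontrivial : ∃ y, Nontrivial (M.fiber y)
  span_range_map : ∀ {y : X} (z : X) {m : M.fiber y}, m ≠ 0 →
    Submodule.span (O.stalk z) (Set.range fun β : y ⟶ z ↦ M.map β m) = ⊤

variable [DecidableEq X]

/-- The additive map `m ↦ c • β m` from the fibre at `d(β)` to the sum of all fibres. -/
def transport {y z : X} (β : y ⟶ z) (c : O.stalk z) : M.fiber y →+ ⨁ z, M.fiber z :=
  (DirectSum.of M.fiber z).comp
    ((DistribSMul.toAddMonoidHom _ c).comp (M.map β).toAddMonoidHom)

theorem transport_apply {y z : X} (β : y ⟶ z) (c : O.stalk z) (m : M.fiber y) :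
    M.transport β c m = DirectSum.of M.fiber z (c • M.map β m) :=
  rfl

theorem transport_zero {y z : X} (β : y ⟶ z) : M.transport β 0 = 0 := by
  ext m
  rw [transport_apply, zero_smul, map_zero, AddMonoidHom.zero_apply]

theorem transport_add {y z : X} (β : y ⟶ z) (c c' : O.stalk z) :
    M.transport β (c + c') = M.transport β c + M.transport β c' := by
  ext m
  simp only [AddMonoidHom.add_apply, transport_apply, add_smul, map_add]

theorem finite_support_transport (f : O.Gamma) (y : X) :
    (Function.support fun β : Σ z : X, (y ⟶ z) ↦ M.transport β.2 (f ⟨β.2⟩)).Finite := by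
  refine (finite_source_fiber f.2 y).subset fun β hβ hfβ ↦ hβ ?_
  beta_reduce
  rw [hfβ, transport_zero]

/-- The restriction of the action of `Γ_c(𝒢, 𝒪)` on finitely supported sections to the sections
supported at `y`. -/
noncomputable def fiberHom (y : X) : O.Gamma →+ M.fiber y →+ ⨁ z, M.fiber z :=
  AddMonoidHom.mk' (fun f ↦ ∑ᶠ β : Σ z : X, (y ⟶ z), M.transport β.2 (f ⟨β.2⟩)) fun f g ↦ by
    rw [← finsum_add_distrib (M.finite_support_transport f y) (M.finite_support_transport g y)]
    simp only [Gamma.add_apply, transport_add]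

/-- The action `(f m)_z = ∑ f(β) β(m_y)`, over the arrows `β : y ⟶ z`, of `Γ_c(𝒢, 𝒪)` on the
finitely supported sections of `M`. -/
noncomputable def sectionHom : O.Gamma →+ AddMonoid.End (⨁ y, M.fiber y) :=
  (DFinsupp.liftAddHom (β := M.fiber)).toAddMonoidHom.comp (AddMonoidHom.pi M.fiberHom)

theorem sectionHom_of (f : O.Gamma) {y : X} (m : M.fiber y) :
    M.sectionHom f (of M.fiber y m) =
      ∑ᶠ β : Σ z : X, (y ⟶ z), of M.fiber β.1 (f ⟨β.2⟩ • M.map β.2 m) :=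
  (toAddMonoid_of _ y m).trans
    ((AddMonoidHom.eval m).map_finsum (M.finite_support_transport f y))

theorem sectionHom_of_of_mem {f : O.Gamma} {W : Set (Arr X)} (hW : Set.InjOn Arr.d W)
    (hf : ∀ γ, γ ∉ W → f γ = 0) {y z : X} {β : y ⟶ z} (hβ : (⟨β⟩ : Arr X) ∈ W)
    (m : M.fiber y) :
    M.sectionHom f (of M.fiber y m) = of M.fiber z (f ⟨β⟩ • M.map β m) := by
  rw [sectionHom_of, finsum_eq_single _ (⟨z, β⟩ : Σ z : X, (y ⟶ z))]
  rintro ⟨z', β'⟩ hne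
  have hβ' : (⟨β'⟩ : Arr X) ∉ W := by
    intro hβ'
    cases hW hβ' hβ rfl
    exact hne rfl
  rw [hf _ hβ', zero_smul, map_zero]

theorem sectionHom_of_eq_zero {f : O.Gamma} {y : X} (hf : ∀ (z : X) (β : y ⟶ z), f ⟨β⟩ = 0)
    (m : M.fiber y) : M.sectionHom f (of M.fiber y m) = 0 := by
  rw [sectionHom_of]
  refine finsum_eq_zero_of_forall_eq_zero fun β ↦ ?_
  rw [hf, zero_smul, map_zero]

theorem sectionHom_eq_zero {f : O.Gamma} {ψ : ⨁ y, M.fiber y}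
    (h : ∀ y, ψ y = 0 ∨ ∀ (z : X) (β : y ⟶ z), f ⟨β⟩ = 0) : M.sectionHom f ψ = 0 := by
  classical
  rw [← DirectSum.sum_support_of ψ, map_sum]
  refine Finset.sum_eq_zero fun y _ ↦ ?_
  rcases h y with hψ | hf
  · rw [hψ, map_zero, map_zero]
  · exact M.sectionHom_of_eq_zero hf _

theorem sectionHom_of_apply (f : O.Gamma) {y : X} (z : X) (m : M.fiber y) :
    M.sectionHom f (of M.fiber y m) z = ∑ᶠ β : y ⟶ z, f ⟨β⟩ • M.map β m := by
  have hfin : (Function.support fun β : Σ z : X, (y ⟶ z) ↦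
      of M.fiber β.1 (f ⟨β.2⟩ • M.map β.2 m)).Finite := by
    refine (finite_source_fiber f.2 y).subset fun β hβ hfβ ↦ hβ ?_
    beta_reduce
    rw [hfβ, zero_smul, map_zero]
  rw [sectionHom_of]
  refine ((DFinsupp.evalAddMonoidHom z).map_finsum hfin).trans ?_
  refine (finsum_sigma_eq_of_forall_ne z fun w hw β ↦ of_eq_of_ne _ _ _ hw.symm).trans ?_
  exact finsum_congr fun β ↦ of_eq_same _ _

variable [IsAmpleGroupoid X]

theorem sectionHom_mul (f g : O.Gamma) :
    M.sectionHom (f * g) = M.sectionHom f * M.sectionHom g := by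
  suffices h : M.sectionHom.comp (AddMonoidHom.mulLeft f) =
      (AddMonoidHom.mulLeft (M.sectionHom f)).comp M.sectionHom from DFunLike.congr_fun h g
  refine Gamma.addHom_ext fun g hg ↦ DirectSum.addHom_ext fun y m ↦ ?_
  change M.sectionHom (f * g) (of M.fiber y m) = M.sectionHom f (M.sectionHom g (of M.fiber y m))
  obtain ⟨W, -, -, hW, -, hg⟩ := hg
  by_cases h : ∃ (z : X) (ρ : y ⟶ z), (⟨ρ⟩ : Arr X) ∈ W
  · obtain ⟨z, ρ, hρ⟩ := h
    rw [M.sectionHom_of_of_mem hW.1 hg hρ, sectionHom_of, sectionHom_of]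
    let e : (Σ w : X, (z ⟶ w)) ≃ Σ w : X, (y ⟶ w) :=
      Equiv.sigmaCongrRight fun w ↦ (asIso ρ).symm.homFromEquiv
    rw [← finsum_comp_equiv e]
    refine finsum_congr fun β ↦ congrArg _ ?_
    change conv f.1 g.1 ⟨ρ ≫ β.2⟩ • M.map (ρ ≫ β.2) m = _
    rw [conv_comp_of_mem hW.1 hg hρ, M.map_comp, (M.map β.2).map_smulₛₗ, smul_smul]
  · push Not at h
    have hg0 (z : X) (ρ : y ⟶ z) : g ⟨ρ⟩ = 0 := hg _ (h z ρ)
    have hfg (z : X) (γ : y ⟶ z) : (f * g) ⟨γ⟩ = 0 :=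
      conv_apply_eq_zero fun w β ↦ Or.inr (hg0 w (γ ≫ Groupoid.inv β))
    rw [M.sectionHom_of_eq_zero hfg, M.sectionHom_of_eq_zero hg0, map_zero]

/-- The representation of `Γ_c(𝒢, 𝒪)` on the finitely supported sections of `M`. -/
noncomputable def sectionRep : O.Gamma →ₙ+* AddMonoid.End (⨁ y, M.fiber y) :=
  { M.sectionHom with map_mul' := M.sectionHom_mul }

-- The value of `ψ` at `y` is isolated by a generator that vanishes over the rest of the support.
theorem exists_sectionRep_eq_of (ψ : ⨁ y, M.fiber y) {y z : X} (β : y ⟶ z) (c : O.stalk z) :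
    ∃ f : O.Gamma, M.sectionRep f ψ = of M.fiber z (c • M.map β (ψ y)) := by
  have : T2Space X := IsEtaleGroupoid.t2
  let S : Set X := {w | ψ w ≠ 0} \ {y}
  have hS : IsClosed S := ((DFinsupp.finite_support ψ).sdiff).isClosed
  obtain ⟨f, hf, hfβ, W, hWS, hW, hβ, hf0⟩ := exists_generator (O := O) (⟨β⟩ : Arr X) c
    (continuous_d.continuousAt.preimage_mem_nhds (hS.isOpen_compl.mem_nhds fun h ↦ h.2 rfl))
  let F : O.Gamma := ⟨f, AddSubgroup.subset_closure hf⟩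
  have hFβ : F ⟨β⟩ = c := hfβ
  have hrest : M.sectionHom F (ψ - of M.fiber y (ψ y)) = 0 := by
    refine M.sectionHom_eq_zero fun w ↦ ?_
    rcases eq_or_ne w y with rfl | hwy
    · exact Or.inl (by rw [DirectSum.sub_apply, of_eq_same, sub_self])
    · refine or_iff_not_imp_left.2 fun hw z β ↦ hf0 _ fun hβ ↦ hWS hβ ⟨?_, hwy⟩
      rwa [DirectSum.sub_apply, of_eq_of_ne _ _ _ hwy, sub_zero] at hw
  refine ⟨F, ?_⟩
  calc M.sectionHom F ψ = M.sectionHom F (of M.fiber y (ψ y)) := by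
        rwa [map_sub, sub_eq_zero] at hrest
    _ = of M.fiber z (c • M.map β (ψ y)) := by
        rw [M.sectionHom_of_of_mem hW.1 hf0 hβ, hFβ]

variable {M}

theorem IsIrreducible.exists_sectionRep_ne_zero (hM : M.IsIrreducible) :
    ∃ f ψ, M.sectionRep f ψ ≠ 0 := by
  obtain ⟨y, hy⟩ := hM.exists_nontrivial
  obtain ⟨m, hm⟩ := exists_ne (0 : M.fiber y)
  obtain ⟨f, hf⟩ := M.exists_sectionRep_eq_of (of M.fiber y m) (𝟙 y) 1
  refine ⟨f, of M.fiber y m, ?_⟩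
  rw [hf, one_smul, of_eq_same, M.map_id]
  exact fun h ↦ hm (of_injective y (h.trans (map_zero _).symm))

theorem IsIrreducible.eq_bot_or_eq_top (hM : M.IsIrreducible) {N : AddSubgroup (⨁ y, M.fiber y)}
    (hN : ∀ f, ∀ ψ ∈ N, M.sectionRep f ψ ∈ N) : N = ⊥ ∨ N = ⊤ := by
  refine or_iff_not_imp_left.2 fun hbot ↦ (AddSubgroup.eq_top_iff' N).2 fun χ ↦ ?_
  have hmap {ψ} (hψ : ψ ∈ N) {y z : X} (β : y ⟶ z) (c : O.stalk z) :
      of M.fiber z (c • M.map β (ψ y)) ∈ N := by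
    obtain ⟨f, hf⟩ := M.exists_sectionRep_eq_of ψ β c
    exact hf ▸ hN f ψ hψ
  let N' (z : X) : Submodule (O.stalk z) (M.fiber z) :=
    { N.comap (of M.fiber z) with
      smul_mem' := fun c n hn ↦ by
        have h := hmap hn (𝟙 z) c
        rwa [of_eq_same, M.map_id] at h }
  obtain ⟨ψ, hψ, hψ0⟩ := N.bot_or_exists_ne_zero.resolve_left hbot
  obtain ⟨y, hy⟩ := DFunLike.ne_iff.1 hψ0
  induction χ using DirectSum.induction_on with
  | zero => exact zero_mem N
  | of z n =>
    have hle : Submodule.span (O.stalk z) (Set.range fun β : y ⟶ z ↦ M.map β (ψ y)) ≤ N' z :=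
      Submodule.span_le.2 <| Set.range_subset_iff.2 fun β ↦ by
        have h := hmap hψ β 1
        rwa [one_smul] at h
    exact hle ((hM.span_range_map z hy).symm ▸ Submodule.mem_top)
  | add _ _ h h' => exact add_mem h h'

theorem IsIrreducible.isSimpleRep (hM : M.IsIrreducible) : IsSimpleRep M.sectionRep :=
  ⟨hM.exists_sectionRep_ne_zero, fun _ ↦ hM.eq_bot_or_eq_top⟩

theorem apply_eq_zero_of_sectionRep_eq_zero {f : O.Gamma} (hf : M.sectionRep f = 0) {y z : X}
    (hli : LinearIndependent (O.stalk z) fun β : y ⟶ z ↦ (M.map β : M.fiber y → M.fiber z))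
    (β : y ⟶ z) : f ⟨β⟩ = 0 := by
  by_contra hβ
  have hfin : {β : y ⟶ z | f ⟨β⟩ ≠ 0}.Finite :=
    (finite_source_fiber f.2 y).preimage sigma_mk_injective.injOn
  refine hβ (linearIndependent_iff'.1 hli hfin.toFinset (fun β ↦ f ⟨β⟩) ?_ β
    (hfin.mem_toFinset.2 hβ))
  funext m
  have hsupp : (Function.support fun β : y ⟶ z ↦ f ⟨β⟩ • M.map β m) ⊆ hfin.toFinset := by
    rw [hfin.coe_toFinset]
    exact Function.support_subset_iff'.2 fun β hβ ↦ by
      rw [not_not.1 hβ, zero_smul]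
  calc (∑ β ∈ hfin.toFinset, f ⟨β⟩ • (M.map β : M.fiber y → M.fiber z)) m
      = ∑ β ∈ hfin.toFinset, f ⟨β⟩ • M.map β m := Finset.sum_apply _ _ _
    _ = M.sectionHom f (of M.fiber y m) z := by
        rw [sectionHom_of_apply, finsum_eq_sum_of_support_subset _ hsupp]
    _ = 0 := DFunLike.congr_fun (DFunLike.congr_fun hf (of M.fiber y m)) z

end EquivariantModule

/-! ### Induction from the isotropy skew group ring -/

/-- The element of `B_x` through which the operator `m ↦ c • β m` acts after the fibres over `y`
and `z` are identified with the fibre over `x` along `γ` and `η`. -/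
noncomputable def toIsotropy {x y z : X} (γ : x ⟶ y) (η : x ⟶ z) (β : y ⟶ z) :
    O.stalk z →+ O.isotropyRing x :=
  (SkewMonoidAlgebra.singleAddHom (End.of (γ ≫ β ≫ Groupoid.inv η))).comp
    (O.act (Groupoid.inv η)).toAddMonoidHom

theorem toIsotropy_apply {x y z : X} (γ : x ⟶ y) (η : x ⟶ z) (β : y ⟶ z) (c : O.stalk z) :
    toIsotropy γ η β c =
      .single (End.of (γ ≫ β ≫ Groupoid.inv η)) (O.act (Groupoid.inv η) c) :=
  rfl

theorem toIsotropy_mul {x y z w : X} (γ : x ⟶ y) (η : x ⟶ z) (ζ : x ⟶ w) (β : y ⟶ z)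
    (β' : z ⟶ w) (c : O.stalk z) (c' : O.stalk w) :
    toIsotropy η ζ β' c' * toIsotropy γ η β c =
      toIsotropy γ ζ (β ≫ β') (c' * O.act β' c) := by
  have hδ : End.of (η ≫ β' ≫ Groupoid.inv ζ) * End.of (γ ≫ β ≫ Groupoid.inv η) =
      End.of (γ ≫ (β ≫ β') ≫ Groupoid.inv ζ) := by
    rw [End.mul_def]
    simp
  have hact : End.of (η ≫ β' ≫ Groupoid.inv ζ) • O.act (Groupoid.inv η) c =
      O.act (Groupoid.inv ζ) (O.act β' c) := by
    change O.act _ _ = _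
    rw [← O.act_comp, ← O.act_comp]
    simp
  simp only [toIsotropy_apply, SkewMonoidAlgebra.single_mul_single, hδ, hact, map_mul]

theorem toIsotropy_id_one {x y : X} (γ : x ⟶ y) : toIsotropy (O := O) γ γ (𝟙 y) 1 = 1 := by
  rw [toIsotropy_apply, Category.id_comp, Groupoid.comp_inv, map_one]
  rfl

theorem toIsotropy_comp {x y z w : X} (γ : x ⟶ y) (ρ : y ⟶ z) (η : x ⟶ w) (β : z ⟶ w)
    (c : O.stalk w) : toIsotropy (γ ≫ ρ) η β c = toIsotropy γ η (ρ ≫ β) c := by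
  simp only [toIsotropy_apply, Category.assoc]

theorem toIsotropy_comp_inv {x y z w : X} (γ : x ⟶ y) (η : x ⟶ w) (α : y ⟶ z) (β : z ⟶ w)
    (c : O.stalk z) :
    toIsotropy γ (η ≫ Groupoid.inv β) α c = toIsotropy γ η (α ≫ β) (O.act β c) := by
  simp only [toIsotropy_apply, ← O.act_comp]
  congr 1
  · simp
  · simp

theorem toIsotropy_eq_single {x y z : X} (γ : x ⟶ y) (η : x ⟶ z) (δ : End x) (a : O.stalk x) :
    toIsotropy γ η (Groupoid.inv γ ≫ δ ≫ η) (O.act η a) = .single δ a := by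
  rw [toIsotropy_apply, ← O.act_comp, Groupoid.comp_inv, O.act_id]
  simp

theorem eq_zero_of_sum_toIsotropy_eq_zero {x y z : X} (γ : x ⟶ y) (η : x ⟶ z)
    {s : Finset (y ⟶ z)} {c : (y ⟶ z) → O.stalk z} (h : ∑ β ∈ s, toIsotropy γ η β (c β) = 0) :
    ∀ β ∈ s, c β = 0 := by
  intro β hβ
  let π : O.isotropyRing x →+ O.stalk x :=
    (Finsupp.applyAddHom (End.of (γ ≫ β ≫ Groupoid.inv η))).comp
      SkewMonoidAlgebra.coeffAddEquiv.toAddMonoidHom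
  have hπ (β' : y ⟶ z) (hβ' : β' ≠ β) : π (toIsotropy γ η β' (c β')) = 0 := by
    refine Finsupp.single_eq_of_ne fun h ↦ hβ' ?_
    rw [Groupoid.inv_eq_inv] at h
    exact ((cancel_mono _).1 ((cancel_epi γ).1 h)).symm
  have hact : O.act (Groupoid.inv η) (c β) = 0 := by
    calc O.act (Groupoid.inv η) (c β) = π (toIsotropy γ η β (c β)) := Finsupp.single_eq_same.symm
      _ = ∑ β' ∈ s, π (toIsotropy γ η β' (c β')) :=
        (Finset.sum_eq_single_of_mem β hβ fun β' _ hβ' ↦ hπ β' hβ').symm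
      _ = 0 := by rw [← map_sum, h, map_zero]
  rw [← O.act_id z (c β), ← Groupoid.inv_comp η, O.act_comp, hact, map_zero]

section Induced

variable (O) (x : X) (V : Type t) [AddCommGroup V] [Module (O.isotropyRing x) V]

/-- The fibre at `y` of the equivariant module induced by `V`: an element is recorded by its images
`φ γ` in `V` under all identifications of the fibre at `y` with `V` along arrows `γ : x ⟶ y`. It is
zero if `y` is not in the orbit of `x`. -/
def inducedFiber (y : X) : AddSubgroup ((x ⟶ y) → V) where
  carrier := {φ | ∀ γ η, φ η = (toIsotropy γ η (𝟙 y) 1 : O.isotropyRing x) • φ γ}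
  zero_mem' γ η := (smul_zero _).symm
  add_mem' {φ ψ} hφ hψ γ η := by
    rw [Pi.add_apply, Pi.add_apply, smul_add, ← hφ γ η, ← hψ γ η]
  neg_mem' {φ} hφ γ η := by rw [Pi.neg_apply, Pi.neg_apply, smul_neg, ← hφ γ η]

variable {O x V}

namespace inducedFiber

instance (y : X) : CoeFun (inducedFiber O x V y) fun _ ↦ (x ⟶ y) → V :=
  ⟨Subtype.val⟩

theorem apply_eq {y : X} (φ : inducedFiber O x V y) (γ η : x ⟶ y) :
    φ η = (toIsotropy γ η (𝟙 y) 1 : O.isotropyRing x) • φ γ :=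
  φ.2 γ η

theorem toIsotropy_smul_apply {y z : X} (φ : inducedFiber O x V y) (γ γ' : x ⟶ y) (η : x ⟶ z)
    (β : y ⟶ z) (c : O.stalk z) :
    (toIsotropy γ' η β c : O.isotropyRing x) • φ γ' =
      (toIsotropy γ η β c : O.isotropyRing x) • φ γ := by
  rw [apply_eq φ γ γ', smul_smul, toIsotropy_mul, Category.id_comp, map_one, mul_one]

theorem ext_of_apply {y : X} {φ ψ : inducedFiber O x V y} (γ : x ⟶ y)
    (h : φ γ = ψ γ) : φ = ψ :=
  Subtype.ext <| funext fun η ↦ by rw [apply_eq φ γ η, apply_eq ψ γ η, h]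

/-- The element of the fibre at `y` corresponding to `v` under the identification along `γ`. -/
noncomputable def ofValue {y : X} (γ : x ⟶ y) (v : V) : inducedFiber O x V y :=
  ⟨fun η ↦ (toIsotropy γ η (𝟙 y) 1 : O.isotropyRing x) • v, fun η ζ ↦ by
    rw [smul_smul, toIsotropy_mul, Category.comp_id, map_one, mul_one]⟩

theorem ofValue_apply {y : X} (γ : x ⟶ y) (v : V) : ofValue (O := O) γ v γ = v := by
  change (toIsotropy γ γ (𝟙 y) 1 : O.isotropyRing x) • v = v
  rw [toIsotropy_id_one, one_smul]

theorem ofValue_add {y : X} (γ : x ⟶ y) (v v' : V) :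
    ofValue (O := O) γ (v + v') = ofValue γ v + ofValue γ v' :=
  Subtype.ext <| funext fun _ ↦ smul_add _ _ _

theorem ofValue_zero {y : X} (γ : x ⟶ y) : ofValue (O := O) (V := V) γ 0 = 0 :=
  Subtype.ext <| funext fun _ ↦ smul_zero _

noncomputable instance (y : X) : Module (O.stalk y) (inducedFiber O x V y) where
  smul c φ := ⟨fun γ ↦ (toIsotropy γ γ (𝟙 y) c : O.isotropyRing x) • φ γ, fun γ η ↦ by
    beta_reduce
    rw [toIsotropy_smul_apply φ γ η, smul_smul, toIsotropy_mul, Category.id_comp, one_mul,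
      O.act_id]⟩
  one_smul φ := Subtype.ext <| funext fun γ ↦ by
    change (toIsotropy γ γ (𝟙 y) 1 : O.isotropyRing x) • φ γ = φ γ
    rw [toIsotropy_id_one, one_smul]
  mul_smul c c' φ := Subtype.ext <| funext fun γ ↦ by
    change (toIsotropy γ γ (𝟙 y) (c * c') : O.isotropyRing x) • φ γ =
      (toIsotropy γ γ (𝟙 y) c : O.isotropyRing x) •
        (toIsotropy γ γ (𝟙 y) c' : O.isotropyRing x) • φ γ
    rw [smul_smul, toIsotropy_mul, Category.id_comp, O.act_id]
  smul_zero c := Subtype.ext <| funext fun γ ↦ smul_zero _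
  smul_add c φ ψ := Subtype.ext <| funext fun γ ↦ smul_add _ _ _
  add_smul c c' φ := Subtype.ext <| funext fun γ ↦ by
    change (toIsotropy γ γ (𝟙 y) (c + c') : O.isotropyRing x) • φ γ = _
    rw [map_add, add_smul]
    rfl
  zero_smul φ := Subtype.ext <| funext fun γ ↦ by
    change (toIsotropy γ γ (𝟙 y) 0 : O.isotropyRing x) • φ γ = 0
    rw [map_zero, zero_smul]

/-- The action of the arrow `β` on the fibres of the induced module. -/
def map {y z : X} (β : y ⟶ z) :
    inducedFiber O x V y →ₛₗ[O.act β] inducedFiber O x V z where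
  toFun φ := ⟨fun η ↦ φ (η ≫ Groupoid.inv β), fun η ζ ↦ by
    beta_reduce
    rw [apply_eq φ (η ≫ Groupoid.inv β) (ζ ≫ Groupoid.inv β), toIsotropy_comp_inv,
      Category.id_comp, toIsotropy_comp, Groupoid.inv_comp, map_one]⟩
  map_add' φ ψ := rfl
  map_smul' c φ := Subtype.ext <| funext fun η ↦ by
    change (toIsotropy (η ≫ Groupoid.inv β) (η ≫ Groupoid.inv β) (𝟙 y) c : O.isotropyRing x) •
        φ (η ≫ Groupoid.inv β) =
      (toIsotropy η η (𝟙 z) (O.act β c) : O.isotropyRing x) • φ (η ≫ Groupoid.inv β)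
    rw [toIsotropy_comp_inv, Category.id_comp, toIsotropy_comp, Groupoid.inv_comp]

theorem smul_map_apply {y z : X} (γ : x ⟶ y) (η : x ⟶ z) (β : y ⟶ z) (c : O.stalk z)
    (φ : inducedFiber O x V y) :
    (c • map β φ) η = (toIsotropy γ η β c : O.isotropyRing x) • φ γ := by
  rw [← toIsotropy_smul_apply φ γ (η ≫ Groupoid.inv β), toIsotropy_comp, Groupoid.inv_comp]
  rfl

theorem ofValue_smul_mem_span_map {y z : X} (γ : x ⟶ y) (η : x ⟶ z) (φ : inducedFiber O x V y)
    (b : O.isotropyRing x) : (ofValue η (b • φ γ) : inducedFiber O x V z) ∈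
      Submodule.span (O.stalk z) (Set.range fun β : y ⟶ z ↦ map β φ) := by
  induction b using SkewMonoidAlgebra.induction_on with
  | zero =>
    rw [zero_smul, ofValue_zero]
    exact zero_mem _
  | single δ a =>
    have h : (ofValue η (SkewMonoidAlgebra.single δ a • φ γ) : inducedFiber O x V z) =
        O.act η a • map (Groupoid.inv γ ≫ δ ≫ η) φ := by
      refine ext_of_apply η ?_
      rw [smul_map_apply γ, toIsotropy_eq_single, ofValue_apply]
    rw [h]
    exact Submodule.smul_mem _ _ (Submodule.subset_span ⟨_, rfl⟩)
  | add b b' hb hb' =>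
    rw [add_smul, ofValue_add]
    exact add_mem hb hb'

end inducedFiber

variable (O x V)

/-- The equivariant module induced by the module `V` over the isotropy skew group ring `B_x`. -/
noncomputable def induced : EquivariantModule O where
  fiber y := inducedFiber O x V y
  map := inducedFiber.map
  map_id y φ := Subtype.ext <| funext fun η ↦ by
    change φ (η ≫ Groupoid.inv (𝟙 y)) = φ η
    simp
  map_comp ρ β φ := Subtype.ext <| funext fun η ↦ by
    change φ (η ≫ Groupoid.inv (ρ ≫ β)) = φ ((η ≫ Groupoid.inv β) ≫ Groupoid.inv ρ)
    simp

theorem induced_isIrreducible [IsSimpleModule (O.isotropyRing x) V] :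
    (induced O x V).IsIrreducible where
  exists_nontrivial := by
    have : Nontrivial V := IsSimpleModule.nontrivial (O.isotropyRing x) V
    obtain ⟨v, hv⟩ := exists_ne (0 : V)
    refine ⟨x, inducedFiber.ofValue (𝟙 x) v, 0, fun h ↦ hv ?_⟩
    rw [← inducedFiber.ofValue_apply (O := O) (𝟙 x) v, h]
    rfl
  span_range_map {y} z φ hφ := by
    obtain ⟨γ, hγ⟩ : ∃ γ : x ⟶ y, φ.1 γ ≠ 0 := by
      by_contra! h
      exact hφ (Subtype.ext (funext h))
    refine (Submodule.eq_top_iff').2 fun (χ : inducedFiber O x V z) ↦ ?_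
    rcases isEmpty_or_nonempty (x ⟶ z) with hz | ⟨⟨η⟩⟩
    · rw [Subsingleton.elim χ 0]
      exact zero_mem _
    obtain ⟨b, hb⟩ := IsSimpleModule.toSpanSingleton_surjective (O.isotropyRing x) hγ (χ η)
    have hχ : χ = inducedFiber.ofValue η (b • φ.1 γ) :=
      inducedFiber.ext_of_apply η (hb.symm.trans (inducedFiber.ofValue_apply η _).symm)
    rw [hχ]
    exact inducedFiber.ofValue_smul_mem_span_map γ η φ b

theorem linearIndependent_induced_map [FaithfulSMul (O.isotropyRing x) V] {y z : X} (γ : x ⟶ y)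
    (η : x ⟶ z) : LinearIndependent (O.stalk z) fun β : y ⟶ z ↦
      (inducedFiber.map β : inducedFiber O x V y → inducedFiber O x V z) := by
  refine linearIndependent_iff'.2 fun s c hc ↦ eq_zero_of_sum_toIsotropy_eq_zero γ η ?_
  refine FaithfulSMul.eq_of_smul_eq_smul (α := V) fun v ↦ ?_
  have h : (∑ β ∈ s, c β • inducedFiber.map β (inducedFiber.ofValue (O := O) γ v)) = 0 := by
    rw [← Pi.zero_apply (M := fun _ : inducedFiber O x V y ↦ inducedFiber O x V z)
      (inducedFiber.ofValue γ v), ← hc, Finset.sum_apply]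
    rfl
  calc (∑ β ∈ s, toIsotropy γ η β (c β)) • v
      = ∑ β ∈ s, (c β • inducedFiber.map β (inducedFiber.ofValue (O := O) γ v)) η := by
        simp only [inducedFiber.smul_map_apply γ, inducedFiber.ofValue_apply, Finset.sum_smul]
    _ = (∑ β ∈ s, c β • inducedFiber.map β (inducedFiber.ofValue (O := O) γ v)).1 η := by
        rw [AddSubgroup.val_finsetSum, Finset.sum_apply]
    _ = (0 : O.isotropyRing x) • v := by
        rw [h, zero_smul]
        rfl

end Induced

theorem isLeftPrimitive_of_isotropyRing [IsAmpleGroupoid X] {x : X}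
    (hx : ∀ f : O.Gamma, (∀ γ : Arr X, γ.d ∈ Orb x → f γ = 0) → f = 0)
    (h : IsLeftPrimitive (O.isotropyRing x)) : IsLeftPrimitive O.Gamma := by
  classical
  obtain ⟨V, _, _, _, _⟩ := h.exists_isSimpleModule
  let M := induced O x V
  have hM : IsSimpleRep M.sectionRep := (induced_isIrreducible O x V).isSimpleRep
  refine ⟨_, inferInstance, M.sectionRep, (injective_iff_map_eq_zero _).2 fun f hf ↦ ?_,
    hM.exists_ne_zero, hM.eq_bot_or_eq_top⟩
  refine hx f ?_
  rintro ⟨β⟩ ⟨⟨γ⟩, rfl, rfl⟩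
  exact M.apply_eq_zero_of_sectionRep_eq_zero hf
    (linearIndependent_induced_map O _ V γ (γ ≫ β)) β

end RingSheaf

end AmpleGroupoid

open AmpleGroupoid in
theorem theoremt {X : Type u} [Groupoid.{v} X] [TopologicalSpace X] [TopologicalSpace (Arr X)]
    [IsAmpleGroupoid X] (O : RingSheaf.{u, v, w} X) :
    (IsLeftPrimitive O.Gamma →
      ∃ x : X, ∀ f : O.Gamma, (∀ γ : Arr X, γ.d ∈ Orb x → f γ = 0) → f = 0) ∧
    (∀ x : X,
      (∀ f : O.Gamma, (∀ γ : Arr X, γ.d ∈ Orb x → f γ = 0) → f = 0) →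
      IsLeftPrimitive (O.isotropyRing x) →
      IsLeftPrimitive O.Gamma) :=
  ⟨RingSheaf.exists_orbit_of_isLeftPrimitive,
    fun _ hx h ↦ RingSheaf.isLeftPrimitive_of_isotropyRing hx h⟩
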